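/- Let $M$ be a smooth $n$-manifold with local coordinates $u^1,\dots,u^n$. Summation over repeated indices is understood. Consider a matrix differential operator of degree 2 on the loop space $L(M)=C^\infty(S^1,M)$, $$P^{ij}=a^{ij}(u)\Big(\frac{d}{dx}\Big)^2+b^{ij}_k(u)\,u^k_x\frac{d}{dx}+c^{ij}_{kl}(u)\,u^k_xu^l_x+c^{ij}_k(u)\,u^k_{xx},$$ given in each coordinate system by smooth coefficients with $\det(a^{ij})\neq 0$ and $c^{ij}_{kl}=c^{ij}_{lk}$. Under a change of coordinates $u\mapsto\tilde u$ it transforms as $\tilde P^{ij}=\frac{\partial\tilde u^i}{\partial u^p}\circ P^{pq}\circ\frac{\partial\tilde u^j}{\partial u^q}$. Assume that $P$ is Hamiltonian: in each coordinate domain the bracket $$\{F,G\}=\int_{S^1}\frac{\delta F}{\delta u^i}\,P^{ij}\Big(\frac{\delta G}{\delta u^j}\Big)\,dx$$ is skew-symmetric and satisfies the Jacobi identity, for all local functionals $F[u]=\int_{S^1} f(x,u,u_x,\dots,u^{(N)})\,dx$ ($f$ smooth, $N$ finite) of loops in that domain. Let $a_{ij}$ be the inverse matrix of $a^{ij}$,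 and let $a=\frac12a_{ij}\,du^i\wedge du^j$. Let $\nabla$ and $\bar\nabla$ be the connections with Christoffel symbols $\Gamma^j_{rk}$ and $\bar\Gamma^j_{rk}$ defined by $c^{ij}_k=-a^{ir}\Gamma^j_{rk}$ and $b^{ij}_k=-2a^{ir}\bar\Gamma^j_{rk}$, so that $$\nabla_ka^{ij}=\partial_ka^{ij}+\Gamma^i_{kr}a^{rj}+\Gamma^j_{kr}a^{ir},\qquad \nabla_ka_{ij}=\partial_ka_{ij}-\Gamma^r_{ki}a_{rj}-\Gamma^r_{kj}a_{ir}.$$ Then the following statements (each required to hold in all the given coordinate systems) are equivalent: 1. The 2-form $a$ is closed. Equivalently, $a$ is symplectic (closed and non-degenerate). Equivalently, $$a^{ir}\frac{\partial a^{jk}}{\partial u^r}+a^{jr}\frac{\partial a^{ki}}{\partial u^r}+a^{kr}\frac{\partial a^{ij}}{\partial u^r}=0\quad\text{for all } i,j,k.$$ Equivalently, $\{f,g\}=a^{ij}\frac{\partial f}{\partial u^i}\frac{\partial g}{\partial u^j}$ is a Poisson bracket on smooth functions on each coordinate domain (it is antisymmetric, bilinear, and satisfies the product rule and the Jacobi identity).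 2. $\nabla_ka^{ij}=0$ for all $i,j,k$. Equivalently, $\nabla_ka_{ij}=0$ for all $i,j,k$. 3. $b^{ij}_k=2c^{ij}_k$ for all $i,j,k$. Equivalently, $\Gamma^k_{ij}=\bar\Gamma^k_{ij}$ for all $i,j,k$. -/

import Mathlib

open scoped ContDiff Manifold

noncomputable section

namespace LoopPoisson

/-- The coordinate space `ℝⁿ`. -/
abbrev Coord (n : ℕ) := EuclideanSpace ℝ (Fin n)

/-- The partial derivative `∂f/∂uᵏ` at `u`. -/
def pd {n : ℕ} (k : Fin n) (f : Coord n → ℝ) (u : Coord n) : ℝ :=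
  fderiv ℝ f u (EuclideanSpace.single k 1)

/-! ### Loops, local functionals, variational derivatives -/

/-- Smooth loops in `U ⊆ ℝⁿ`, as smooth maps on `ℝ` of period `1` (so `S¹ = ℝ/ℤ`). -/
def IsLoop {n : ℕ} (U : Set (Coord n)) (u : ℝ → Coord n) : Prop :=
  ContDiff ℝ ∞ u ∧ Function.Periodic u 1 ∧ ∀ x, u x ∈ U

/-- `F` is a local functional on the loop space of `U`:
`F[u] = ∫_{S¹} f(x, u, u_x, …, u^{(N)}) dx` with a smooth density `f` of some finite order `N`.
Only the values of `F` on loops in `U` matter. -/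
def IsLocalFunctional {n : ℕ} (U : Set (Coord n)) (F : (ℝ → Coord n) → ℝ) : Prop :=
  ∃ (N : ℕ) (f : ℝ × (Fin (N + 1) → Coord n) → ℝ),
    ContDiffOn ℝ ∞ f {z | z.2 0 ∈ U} ∧
    (∀ x p, f (x + 1, p) = f (x, p)) ∧
    ∀ u, IsLoop U u → F u = ∫ x in (0 : ℝ)..1, f (x, fun s => iteratedDeriv s u x)

/-- `w = δF/δu` at the loop `u`: `w` is smooth and periodic, and
`d/dε F[u + ε v] = ∫ wᵢ vⁱ dx` at `ε = 0` for every smooth periodic `v`. -/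
def HasVarDerivAt {n : ℕ} (F : (ℝ → Coord n) → ℝ) (u w : ℝ → Coord n) : Prop :=
  IsLoop Set.univ w ∧
    ∀ v : ℝ → Coord n, IsLoop Set.univ v →
      HasDerivAt (fun ε : ℝ => F (u + ε • v)) (∫ x in (0 : ℝ)..1, ∑ i, w x i * v x i) 0

/-- The variational derivative is unique. -/
theorem HasVarDerivAt.unique {n : ℕ} {F : (ℝ → Coord n) → ℝ} {u w w' : ℝ → Coord n}
    (h : HasVarDerivAt F u w) (h' : HasVarDerivAt F u w') : w = w' := by
  have hw : Continuous w := h.1.1.continuous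
  have hw' : Continuous w' := h'.1.1.continuous
  have hv : IsLoop Set.univ (w - w') :=
    ⟨h.1.1.sub h'.1.1, h.1.2.1.sub h'.1.2.1, fun _ => Set.mem_univ _⟩
  have e := (h.2 _ hv).unique (h'.2 _ hv)
  have c1 : Continuous fun x => ∑ i, w x i * (w - w') x i := by
    simp only [Pi.sub_apply, PiLp.sub_apply]; fun_prop
  have c2 : Continuous fun x => ∑ i, w' x i * (w - w') x i := by
    simp only [Pi.sub_apply, PiLp.sub_apply]; fun_prop
  have c3 : Continuous fun x => ∑ i, (w x i - w' x i) ^ 2 := by fun_prop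
  have e0 : ∫ x in (0 : ℝ)..1, ∑ i, (w x i - w' x i) ^ 2 = 0 := by
    rw [← sub_eq_zero, ← intervalIntegral.integral_sub (c1.intervalIntegrable _ _)
      (c2.intervalIntegrable _ _)] at e
    rw [← e]
    congr 1
    ext x
    rw [← Finset.sum_sub_distrib]
    refine Finset.sum_congr rfl fun i _ => ?_
    simp only [Pi.sub_apply, PiLp.sub_apply]
    ring
  have key : ∀ x ∈ Set.Icc (0 : ℝ) 1, ∑ i, (w x i - w' x i) ^ 2 = 0 := by
    by_contra! hne
    obtain ⟨x, hx, hx'⟩ := hne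
    have := intervalIntegral.integral_pos (zero_lt_one' ℝ) c3.continuousOn
      (fun x _ => Finset.sum_nonneg fun i _ => sq_nonneg _)
      ⟨x, hx, lt_of_le_of_ne (Finset.sum_nonneg fun i _ => sq_nonneg _) (Ne.symm hx')⟩
    exact this.ne' e0
  have on : ∀ x ∈ Set.Icc (0 : ℝ) 1, w x = w' x := by
    intro x hx
    ext i
    have := (Finset.sum_eq_zero_iff_of_nonneg (fun i _ => sq_nonneg _)).1 (key x hx) i
      (Finset.mem_univ i)
    exact sub_eq_zero.1 (pow_eq_zero_iff (two_ne_zero) |>.1 this)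
  ext1 x
  have p1 := h.1.2.1.sub_zsmul_eq (x := x) ⌊x⌋
  have p2 := h'.1.2.1.sub_zsmul_eq (x := x) ⌊x⌋
  rw [← p1, ← p2]
  refine on _ ?_
  have h1 := Int.floor_le x
  have h2 := (Int.lt_floor_add_one x).le
  constructor <;> rw [zsmul_eq_mul, mul_one] <;> linarith

open Classical in
/-- The variational derivative `δF/δu`, as a function of the loop `u` (and `0` where it does not
exist; it exists for local functionals). -/
def varDeriv {n : ℕ} (F : (ℝ → Coord n) → ℝ) (u : ℝ → Coord n) : ℝ → Coord n :=
  if h : ∃ w, HasVarDerivAt F u w then h.choose else 0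

theorem HasVarDerivAt.varDeriv_eq {n : ℕ} {F : (ℝ → Coord n) → ℝ} {u w : ℝ → Coord n}
    (h : HasVarDerivAt F u w) : varDeriv F u = w := by
  have hex : ∃ w, HasVarDerivAt F u w := ⟨w, h⟩
  rw [varDeriv, dif_pos hex]
  exact hex.choose_spec.unique h

/-! ### Operators of degree two in one coordinate system -/

/-- The coefficients `aⁱʲ(u)`, `bⁱʲₖ(u)`, `cⁱʲₖ(u)`, `cⁱʲₖₗ(u)` of
`Pⁱʲ = aⁱʲ (d/dx)² + bⁱʲₖ uᵏₓ d/dx + cⁱʲₖₗ uᵏₓ uˡₓ + cⁱʲₖ uᵏₓₓ` in one coordinate system. -/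
structure Coeffs (n : ℕ) where
  a : Coord n → Matrix (Fin n) (Fin n) ℝ
  b : Fin n → Fin n → Fin n → Coord n → ℝ
  c : Fin n → Fin n → Fin n → Coord n → ℝ
  cc : Fin n → Fin n → Fin n → Fin n → Coord n → ℝ

namespace Coeffs

variable {n : ℕ} (P : Coeffs n)

/-- Admissible coefficients on `U`: all are smooth, `aⁱʲ` is non-degenerate, and `cⁱʲₖₗ` is
symmetric in `k, l`. -/
structure IsAdmissible (U : Set (Coord n)) : Prop where
  smooth_a : ∀ i j, ContDiffOn ℝ ∞ (fun u => P.a u i j) U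
  smooth_b : ∀ i j k, ContDiffOn ℝ ∞ (P.b i j k) U
  smooth_c : ∀ i j k, ContDiffOn ℝ ∞ (P.c i j k) U
  smooth_cc : ∀ i j k l, ContDiffOn ℝ ∞ (P.cc i j k l) U
  nondegenerate : ∀ u ∈ U, (P.a u).det ≠ 0
  symm : ∀ i j k l, ∀ u ∈ U, P.cc i j k l u = P.cc i j l k u

/-- `(Pⁱʲ ψⱼ)(x)` along the loop `u`. -/
def op (u ψ : ℝ → Coord n) (i : Fin n) (x : ℝ) : ℝ :=
  ∑ j, (P.a (u x) i j * iteratedDeriv 2 ψ x j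
    + (∑ k, P.b i j k (u x) * deriv u x k) * deriv ψ x j
    + ((∑ k, ∑ l, P.cc i j k l (u x) * deriv u x k * deriv u x l)
      + ∑ k, P.c i j k (u x) * iteratedDeriv 2 u x k) * ψ x j)

/-- The bracket `{F, G} = ∫ δF/δuⁱ Pⁱʲ (δG/δuʲ) dx`. -/
def bracket (F G : (ℝ → Coord n) → ℝ) (u : ℝ → Coord n) : ℝ :=
  ∫ x in (0 : ℝ)..1, ∑ i, varDeriv F u x i * P.op u (varDeriv G u) i x

/-- `P` is a Hamiltonian operator on `U`: its bracket is skew-symmetric and satisfies the Jacobi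
identity, for local functionals on the loop space of `U`. -/
def IsHamiltonianOn (U : Set (Coord n)) : Prop :=
  (∀ F G, IsLocalFunctional U F → IsLocalFunctional U G →
    ∀ u, IsLoop U u → P.bracket F G u = -P.bracket G F u) ∧
  (∀ F G H, IsLocalFunctional U F → IsLocalFunctional U G → IsLocalFunctional U H →
    ∀ u, IsLoop U u →
      P.bracket (P.bracket F G) H u + P.bracket (P.bracket G H) F u
        + P.bracket (P.bracket H F) G u = 0)

/-- `aᵢⱼ`, the inverse matrix of `aⁱʲ`. -/
def aLow (i j : Fin n) (u : Coord n) : ℝ := (P.a u)⁻¹ i j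

/-- The Christoffel symbols `Γᵏᵢⱼ = -aᵢᵣ cʳᵏⱼ` of `∇`, that is `cⁱʲₖ = -aⁱʳ Γʲᵣₖ`. -/
def Gam (k i j : Fin n) (u : Coord n) : ℝ := -∑ r, P.aLow i r u * P.c r k j u

/-- The Christoffel symbols `Γ̄ᵏᵢⱼ = -½ aᵢᵣ bʳᵏⱼ` of `∇̄`, that is `bⁱʲₖ = -2 aⁱʳ Γ̄ʲᵣₖ`. -/
def GamBar (k i j : Fin n) (u : Coord n) : ℝ := -(1 / 2) * ∑ r, P.aLow i r u * P.b r k j u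

/-- `∇ₖ aⁱʲ`. -/
def nablaUp (k i j : Fin n) (u : Coord n) : ℝ :=
  pd k (fun u => P.a u i j) u
    + ∑ r, P.Gam i k r u * P.a u r j + ∑ r, P.Gam j k r u * P.a u i r

/-- `∇ₖ aᵢⱼ`. -/
def nablaLow (k i j : Fin n) (u : Coord n) : ℝ :=
  pd k (P.aLow i j) u
    - ∑ r, P.Gam r k i u * P.aLow r j u - ∑ r, P.Gam r k j u * P.aLow i r u

/-- `duⁱ ∧ duʲ`, that is `(v, w) ↦ vⁱ wʲ - vʲ wⁱ`. -/
def dudu (i j : Fin n) : Coord n [⋀^Fin 2]→L[ℝ] ℝ :=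
  ContinuousMultilinearMap.alternatization
    ((ContinuousMultilinearMap.mkPiAlgebra ℝ (Fin 2) ℝ).compContinuousLinearMap
      fun s => EuclideanSpace.proj (![i, j] s))

theorem dudu_apply (i j : Fin n) (v w : Coord n) :
    dudu i j ![v, w] = v i * w j - v j * w i := by
  simp [dudu, ContinuousMultilinearMap.alternatization_apply_apply, Fin.prod_univ_two,
    Finset.univ_perm_fin_succ, Fin.sum_univ_succ, ← Finset.univ_product_univ]
  ring

/-- The 2-form `a = ½ aᵢⱼ duⁱ ∧ duʲ`. -/
def form (u : Coord n) : Coord n [⋀^Fin 2]→L[ℝ] ℝ :=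
  (1 / 2 : ℝ) • ∑ i, ∑ j, P.aLow i j u • dudu i j

/-- The 2-form `a` is closed on `U`. -/
def IsClosedOn (U : Set (Coord n)) : Prop := ∀ u ∈ U, extDeriv P.form u = 0

/-- The 2-form `a` is symplectic on `U`: closed and non-degenerate. -/
def IsSymplecticOn (U : Set (Coord n)) : Prop :=
  P.IsClosedOn U ∧ ∀ u ∈ U, ∀ v : Coord n, (∀ w, P.form u ![v, w] = 0) → v = 0

/-- The equation `aⁱʳ ∂ᵣaʲᵏ + aʲʳ ∂ᵣaᵏⁱ + aᵏʳ ∂ᵣaⁱʲ = 0` on `U`. -/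
def JacobiEqOn (U : Set (Coord n)) : Prop :=
  ∀ u ∈ U, ∀ i j k,
    ∑ r, (P.a u i r * pd r (fun u => P.a u j k) u + P.a u j r * pd r (fun u => P.a u k i) u
      + P.a u k r * pd r (fun u => P.a u i j) u) = 0

/-- `{f, g} = aⁱʲ ∂f/∂uⁱ ∂g/∂uʲ`. -/
def fnBracket (f g : Coord n → ℝ) (u : Coord n) : ℝ :=
  ∑ i, ∑ j, P.a u i j * pd i f u * pd j g u

/-- `{f, g} = aⁱʲ ∂f/∂uⁱ ∂g/∂uʲ` is a Poisson bracket on `C^∞(U)`. -/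
structure IsPoissonOn (U : Set (Coord n)) : Prop where
  smooth : ∀ f g, ContDiffOn ℝ ∞ f U → ContDiffOn ℝ ∞ g U → ContDiffOn ℝ ∞ (P.fnBracket f g) U
  antisymm : ∀ f g, ContDiffOn ℝ ∞ f U → ContDiffOn ℝ ∞ g U →
    ∀ u ∈ U, P.fnBracket f g u = -P.fnBracket g f u
  linear : ∀ f g h, ContDiffOn ℝ ∞ f U → ContDiffOn ℝ ∞ g U → ContDiffOn ℝ ∞ h U →
    ∀ (s t : ℝ), ∀ u ∈ U,
      P.fnBracket (s • f + t • g) h u = s * P.fnBracket f h u + t * P.fnBracket g h u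
  product : ∀ f g h, ContDiffOn ℝ ∞ f U → ContDiffOn ℝ ∞ g U → ContDiffOn ℝ ∞ h U →
    ∀ u ∈ U, P.fnBracket (f * g) h u = f u * P.fnBracket g h u + g u * P.fnBracket f h u
  jacobi : ∀ f g h, ContDiffOn ℝ ∞ f U → ContDiffOn ℝ ∞ g U → ContDiffOn ℝ ∞ h U →
    ∀ u ∈ U, P.fnBracket (P.fnBracket f g) h u + P.fnBracket (P.fnBracket g h) f u
      + P.fnBracket (P.fnBracket h f) g u = 0

end Coeffs

/-! ### Operators of degree two on a manifold -/

/-- The Jacobian `∂ũⁱ/∂uᵖ` of `ũ = τ(u)`. -/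
def jac {n : ℕ} (τ : Coord n → Coord n) (i p : Fin n) (u : Coord n) : ℝ :=
  pd p (fun u => τ u i) u

/-- A matrix differential operator of degree two on the loop space of `M`: admissible coefficients
in each chart of the atlas, related by
`P̃ⁱʲ = (∂ũⁱ/∂uᵖ) ∘ Pᵖᵠ ∘ (∂ũʲ/∂uᵠ)` under a change of coordinates `u ↦ ũ`. -/
structure DegreeTwoOperator (n : ℕ) (M : Type*) [TopologicalSpace M]
    [ChartedSpace (Coord n) M] where
  coeffs : atlas (Coord n) M → Coeffs n
  admissible : ∀ e, (coeffs e).IsAdmissible e.1.target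
  transform : ∀ e e' : atlas (Coord n) M, ∀ u ψ : ℝ → Coord n,
    IsLoop (e.1.symm.trans e'.1).source u → IsLoop Set.univ ψ → ∀ i x,
      (coeffs e').op (e.1.symm.trans e'.1 ∘ u) ψ i x =
        ∑ p, jac (e.1.symm.trans e'.1) i p (u x) *
          (coeffs e).op u
            (fun y => WithLp.toLp 2 fun q =>
              ∑ j, jac (e.1.symm.trans e'.1) j q (u y) * ψ y j) p x

/-- `P` is Hamiltonian: in every coordinate system its bracket is a Poisson bracket on the loops
that lie in the coordinate domain. -/
def DegreeTwoOperator.IsHamiltonian {n : ℕ} {M : Type*} [TopologicalSpace M]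
    [ChartedSpace (Coord n) M] (P : DegreeTwoOperator n M) : Prop :=
  ∀ e, (P.coeffs e).IsHamiltonianOn e.1.target

end LoopPoisson

end

open scoped ContDiff Manifold

noncomputable section

namespace LoopPoisson

open Set Filter Topology MeasureTheory

/-! The Hamiltonian property is tested only on linear functionals ∫ φ(x) uⁱ dx, and only at constant
loops. The variational derivative of such a functional is the fixed covector φ duⁱ, all
x-derivatives of u vanish at a constant loop, and the first variation of the bracket of two linear
functionals sees only ∂a, b and cⁱʲₖ; the coefficients cⁱʲₖₗ enter quadratically and drop out.

Skew-symmetry then gives aⁱʲ = -aʲⁱ (`a_antisymm`) and ∂ₖaⁱʲ = bⁱʲₖ - cⁱʲₖ - cʲⁱₖ (`pd_a`). With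
cosine modes as test functions, the Jacobi identity becomes an algebraic relation whose numerical
coefficients are monomials in frequencies of sum zero. Frequencies (1, -1, 0) give the symmetry of
cʲˡₖaᵏⁱ in i, j (`c_symm`), which says that ∇ is torsion-free; together with `pd_a` it yields ∇ₖaⁱʲ
= bⁱʲₖ - 2cⁱʲₖ (`nablaUp_eq`). Frequencies (2, -1, -1) (`jacobi_cosMode`) give the invariance of
(∇ₖaʲˡ)aᵏⁱ under cyclic permutations of i, j, l.

Since ∇ is torsion-free, ∂ may be replaced by ∇ in the cyclic sum of (∂ₖaʲˡ)aᵏⁱ, so by the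
invariance this sum is three times a single term (`cyclic_sum`). As a is non-degenerate, the Jacobi
equation for aⁱʲ holds exactly when b = 2c, that is, when ∇a = 0.

The remaining equivalences are classical. Contracting the components of da with three copies of aⁱʲ
gives the left side of the Jacobi equation up to sign; in the Jacobi identity for functions the
second derivatives cancel; differentiating the inverse matrix relates ∇ₖaⁱʲ to ∇ₖaᵢⱼ; and Γ = Γ̄ is
b = 2c with one index lowered. -/

/-! ### Calculus on the circle: parameter integrals, periodic functions, loops -/

/-- Differentiation under the integral sign for a continuously differentiable integrand on a
neighbourhood of a compact interval. -/
theorem hasDerivAt_intervalIntegral_of_contDiffOn {W : Set (ℝ × ℝ)} (hW : IsOpen W)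
    (h0 : ∀ x, ((0 : ℝ), x) ∈ W) {Φ : ℝ × ℝ → ℝ} (hΦ : ContDiffOn ℝ 1 Φ W) {Φ' : ℝ → ℝ}
    (hΦ' : ∀ x, HasDerivAt (fun ε => Φ (ε, x)) (Φ' x) 0) :
    HasDerivAt (fun ε : ℝ => ∫ x in (0 : ℝ)..1, Φ (ε, x)) (∫ x in (0 : ℝ)..1, Φ' x) 0 := by
  -- The tube lemma makes the range of ε uniform in x ∈ [0, 1]; compactness of the tube then bounds
  -- the ε-derivative by the constant that dominates the integrand.
  obtain ⟨V, V', hV, -, h0V, hV', hVW⟩ := generalized_tube_lemma (isCompact_singleton (x := (0 : ℝ)))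
    (isCompact_Icc (a := (0 : ℝ)) (b := 1)) hW (by rintro ⟨a, b⟩ ⟨rfl, -⟩; exact h0 b)
  obtain ⟨δ, hδ, hδV⟩ := Metric.nhds_basis_closedBall.mem_iff.1 (hV.mem_nhds (h0V rfl))
  have hsub : Metric.closedBall (0 : ℝ) δ ×ˢ Icc (0 : ℝ) 1 ⊆ W :=
    (prod_mono hδV hV').trans hVW
  have hder : ∀ z ∈ W, HasDerivAt (fun ε => Φ (ε, z.2)) (fderiv ℝ Φ z (1, 0)) z.1 := by
    intro z hz
    have h1 : HasFDerivAt Φ (fderiv ℝ Φ z) (z.1, z.2) :=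
      ((hΦ.differentiableOn one_ne_zero).differentiableAt (hW.mem_nhds hz)).hasFDerivAt
    exact h1.comp_hasDerivAt z.1 ((hasDerivAt_id z.1).prodMk (hasDerivAt_const z.1 z.2))
  have hcont : ContinuousOn (fun z => fderiv ℝ Φ z (1, 0)) W :=
    (hΦ.continuousOn_fderiv_of_isOpen hW le_rfl).clm_apply continuousOn_const
  obtain ⟨C, hC⟩ := ((isCompact_closedBall (0 : ℝ) δ).prod
    (isCompact_Icc (a := (0 : ℝ)) (b := 1))).exists_bound_of_continuousOn (hcont.mono hsub)
  have hI : uIoc (0 : ℝ) 1 ⊆ Icc 0 1 := by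
    rw [uIoc_of_le zero_le_one]; exact Ioc_subset_Icc_self
  have hslice : ∀ ε ∈ Metric.closedBall (0 : ℝ) δ, ∀ f : ℝ × ℝ → ℝ, ContinuousOn f W →
      ContinuousOn (fun x => f (ε, x)) (Icc 0 1) := by
    intro ε hε f hf
    exact hf.comp (by fun_prop) fun x hx => hsub ⟨hε, hx⟩
  have hmem0 : (0 : ℝ) ∈ Metric.closedBall (0 : ℝ) δ := Metric.mem_closedBall_self hδ.le
  have hΦ'eq : Φ' = fun x => fderiv ℝ Φ (0, x) (1, 0) :=
    funext fun x => (hΦ' x).unique (hder (0, x) (h0 x))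
  have key := intervalIntegral.hasDerivAt_integral_of_dominated_loc_of_deriv_le
    (μ := volume) (a := 0) (b := 1) (bound := fun _ => C) (F := fun ε x => Φ (ε, x))
    (F' := fun ε x => fderiv ℝ Φ (ε, x) (1, 0)) (x₀ := (0 : ℝ))
    (Metric.closedBall_mem_nhds (0 : ℝ) hδ) ?_ ?_ ?_ ?_ ?_ ?_
  · rw [hΦ'eq]; exact key.2
  · filter_upwards [Metric.closedBall_mem_nhds (0 : ℝ) hδ] with ε hε
    exact ((hslice ε hε Φ hΦ.continuousOn).mono hI).aestronglyMeasurable measurableSet_uIoc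
  · refine ContinuousOn.intervalIntegrable ?_
    rw [uIcc_of_le zero_le_one]
    exact hslice 0 hmem0 Φ hΦ.continuousOn
  · exact ((hslice 0 hmem0 _ hcont).mono hI).aestronglyMeasurable measurableSet_uIoc
  · exact ae_of_all _ fun x hx ε hε => hC (ε, x) ⟨hε, hI hx⟩
  · exact intervalIntegrable_const
  · exact ae_of_all _ fun x hx ε hε => hder (ε, x) (hsub ⟨hε, hI hx⟩)

theorem periodic_deriv {E : Type*} [NormedAddCommGroup E] [NormedSpace ℝ E] {f : ℝ → E} {T : ℝ}
    (hf : Function.Periodic f T) : Function.Periodic (deriv f) T := by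
  intro x
  rw [← deriv_comp_add_const]
  exact congrArg (fun g => deriv g x) (funext hf)

/-- The integral over a period of the derivative of a periodic function vanishes. -/
theorem integral_eq_zero_of_periodic {f f' : ℝ → ℝ} (hf : Function.Periodic f 1)
    (hd : ∀ x, HasDerivAt f (f' x) x) (hc : Continuous f') :
    ∫ x in (0 : ℝ)..1, f' x = 0 := by
  rw [intervalIntegral.integral_eq_sub_of_hasDerivAt (fun x _ => hd x) (hc.intervalIntegrable _ _)]
  have := hf 0
  rw [zero_add] at this
  rw [this, sub_self]

/-- Smooth functions on the circle. -/
structure IsCircleFun (φ : ℝ → ℝ) : Prop where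
  smooth : ContDiff ℝ ∞ φ
  periodic : Function.Periodic φ 1

namespace IsCircleFun

variable {φ ψ : ℝ → ℝ}

theorem deriv (hφ : IsCircleFun φ) : IsCircleFun (deriv φ) :=
  ⟨hφ.smooth.deriv' , periodic_deriv hφ.periodic⟩

theorem hasDerivAt (hφ : IsCircleFun φ) (x : ℝ) : HasDerivAt φ (_root_.deriv φ x) x :=
  (hφ.smooth.differentiable (by simp) x).hasDerivAt

theorem mul (hφ : IsCircleFun φ) (hψ : IsCircleFun ψ) : IsCircleFun fun x => φ x * ψ x :=
  ⟨hφ.smooth.mul hψ.smooth, fun x => by simp only [hφ.periodic x, hψ.periodic x]⟩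

theorem add (hφ : IsCircleFun φ) (hψ : IsCircleFun ψ) : IsCircleFun fun x => φ x + ψ x :=
  ⟨hφ.smooth.add hψ.smooth, fun x => by simp only [hφ.periodic x, hψ.periodic x]⟩

theorem sub (hφ : IsCircleFun φ) (hψ : IsCircleFun ψ) : IsCircleFun fun x => φ x - ψ x :=
  ⟨hφ.smooth.sub hψ.smooth, fun x => by simp only [hφ.periodic x, hψ.periodic x]⟩

theorem const_mul (hφ : IsCircleFun φ) (r : ℝ) : IsCircleFun fun x => r * φ x :=
  ⟨contDiff_const.mul hφ.smooth, fun x => by simp only [hφ.periodic x]⟩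

end IsCircleFun

variable {n : ℕ}

theorem IsLoop.coord {U : Set (Coord n)} {v : ℝ → Coord n} (hv : IsLoop U v) (k : Fin n) :
    IsCircleFun fun x => v x k :=
  ⟨(EuclideanSpace.proj (𝕜 := ℝ) k).contDiff.comp hv.1, fun x => by simp only [hv.2.1 x]⟩

theorem isLoop_toLp {w : Fin n → ℝ → ℝ} (hw : ∀ k, IsCircleFun (w k)) :
    IsLoop univ fun x => (WithLp.toLp 2 fun k => w k x : Coord n) :=
  ⟨contDiff_euclidean.2 fun k => (hw k).smooth,
    fun x => by simp only [fun k => (hw k).periodic x], fun _ => mem_univ _⟩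

theorem deriv_coord {v : ℝ → Coord n} {x : ℝ} (hv : DifferentiableAt ℝ v x) (k : Fin n) :
    deriv v x k = deriv (fun y => v y k) x :=
  ((EuclideanSpace.proj (𝕜 := ℝ) k).hasFDerivAt.comp_hasDerivAt x hv.hasDerivAt).deriv.symm

theorem iteratedDeriv_two_coord {U : Set (Coord n)} {v : ℝ → Coord n} (hv : IsLoop U v)
    (k : Fin n) (x : ℝ) :
    iteratedDeriv 2 v x k = deriv (deriv fun y => v y k) x := by
  rw [iteratedDeriv_succ, iteratedDeriv_one,
    deriv_coord ((hv.1.deriv' (n := ∞)).differentiable (by simp) x)]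
  congr 1
  exact funext fun y => deriv_coord (hv.1.differentiable (by simp) y) k

/-! ### Linear functionals, their brackets, and the first variation at a constant loop -/

/-- The covector field `φ(x) duⁱ` along loops. -/
def testCovector (φ : ℝ → ℝ) (i : Fin n) (x : ℝ) : Coord n :=
  WithLp.toLp 2 fun k => if k = i then φ x else 0

/-- The linear local functional `u ↦ ∫ φ(x) uⁱ(x) dx`. -/
def linFun (φ : ℝ → ℝ) (i : Fin n) (u : ℝ → Coord n) : ℝ :=
  ∫ x in (0 : ℝ)..1, φ x * u x i

theorem isLoop_testCovector {φ : ℝ → ℝ} (hφ : IsCircleFun φ) (i : Fin n) :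
    IsLoop univ (testCovector φ i) := by
  refine isLoop_toLp (w := fun k x => if k = i then φ x else 0) fun k => ?_
  by_cases h : k = i
  · simpa [h] using hφ
  · simpa [h] using (⟨contDiff_const, fun _ => rfl⟩ : IsCircleFun fun _ => (0 : ℝ))

theorem isLocalFunctional_linFun (U : Set (Coord n)) {φ : ℝ → ℝ} (hφ : IsCircleFun φ)
    (i : Fin n) : IsLocalFunctional U (linFun φ i) := by
  refine ⟨0, fun z => φ z.1 * z.2 0 i, ?_, ?_, ?_⟩
  · refine ContDiff.contDiffOn ?_
    refine (hφ.smooth.comp contDiff_fst).mul ?_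
    exact (EuclideanSpace.proj (𝕜 := ℝ) i).contDiff.comp
      ((contDiff_apply ℝ (Coord n) (0 : Fin 1)).comp contDiff_snd)
  · intro x p
    simp only [hφ.periodic x]
  · intro u _
    simp [linFun]

/-- Linearity makes the difference quotient exact. The gradient does not depend on u, so in a double
bracket of linear functionals only the inner bracket has a gradient that varies with the loop. -/
theorem hasVarDerivAt_linFun {φ : ℝ → ℝ} (hφ : IsCircleFun φ) (i : Fin n) {U : Set (Coord n)}
    {u : ℝ → Coord n} (hu : IsLoop U u) :
    HasVarDerivAt (linFun φ i) u (testCovector φ i) := by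
  refine ⟨isLoop_testCovector hφ i, fun v hv => ?_⟩
  have e : (fun ε : ℝ => linFun φ i (u + ε • v)) = fun ε => linFun φ i u + ε * linFun φ i v := by
    funext ε
    have c1 : Continuous fun x => φ x * u x i :=
      hφ.smooth.continuous.mul (hu.coord i).smooth.continuous
    have c2 : Continuous fun x => φ x * v x i :=
      hφ.smooth.continuous.mul (hv.coord i).smooth.continuous
    have c3 : Continuous fun x => ε * (φ x * v x i) := continuous_const.mul c2
    rw [linFun, linFun, linFun, ← intervalIntegral.integral_const_mul,
      ← intervalIntegral.integral_add (c1.intervalIntegrable _ _)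
        (c3.intervalIntegrable _ _)]
    refine intervalIntegral.integral_congr fun x _ => ?_
    simp only [Pi.add_apply, Pi.smul_apply, PiLp.add_apply, PiLp.smul_apply, smul_eq_mul]
    ring
  rw [e]
  have e2 : (∫ x in (0 : ℝ)..1, ∑ k, testCovector φ i x k * v x k) = linFun φ i v := by
    simp [testCovector, linFun]
  rw [e2]
  simpa using ((hasDerivAt_id (0 : ℝ)).mul_const (linFun φ i v)).const_add (linFun φ i u)

namespace Coeffs

variable (P : Coeffs n)

theorem op_testCovector {ψ : ℝ → ℝ} (hψ : IsCircleFun ψ) (u : ℝ → Coord n) (i j : Fin n)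
    (x : ℝ) :
    P.op u (testCovector ψ j) i x = P.a (u x) i j * deriv (deriv ψ) x
      + (∑ k, P.b i j k (u x) * deriv u x k) * deriv ψ x
      + ((∑ k, ∑ l, P.cc i j k l (u x) * deriv u x k * deriv u x l)
        + ∑ k, P.c i j k (u x) * iteratedDeriv 2 u x k) * ψ x := by
  have hl := isLoop_testCovector (n := n) hψ j
  have h0 : ∀ k, (fun y => testCovector ψ j y k) = fun y => if k = j then ψ y else 0 :=
    fun k => rfl
  have h1 : ∀ k x, deriv (testCovector ψ j) x k = if k = j then deriv ψ x else 0 := by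
    intro k x
    rw [deriv_coord (hl.1.differentiable (by simp) x), h0]
    by_cases h : k = j <;> simp [h]
  have h2 : ∀ k x, iteratedDeriv 2 (testCovector ψ j) x k =
      if k = j then deriv (deriv ψ) x else 0 := by
    intro k x
    rw [iteratedDeriv_two_coord hl, h0]
    by_cases h : k = j <;> simp [h]
  rw [op, Finset.sum_eq_single j]
  · simp [h1, h2, testCovector]
  · intro k _ hk
    simp [h1, h2, testCovector, hk]
  · simp

theorem bracket_linFun {φ ψ : ℝ → ℝ} (hφ : IsCircleFun φ) (hψ : IsCircleFun ψ) (i j : Fin n)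
    {U : Set (Coord n)} {u : ℝ → Coord n} (hu : IsLoop U u) :
    P.bracket (linFun φ i) (linFun ψ j) u =
      ∫ x in (0 : ℝ)..1, φ x * (P.a (u x) i j * deriv (deriv ψ) x
        + (∑ k, P.b i j k (u x) * deriv u x k) * deriv ψ x
        + ((∑ k, ∑ l, P.cc i j k l (u x) * deriv u x k * deriv u x l)
          + ∑ k, P.c i j k (u x) * iteratedDeriv 2 u x k) * ψ x) := by
  rw [bracket, (hasVarDerivAt_linFun hφ i hu).varDeriv_eq,
    (hasVarDerivAt_linFun hψ j hu).varDeriv_eq]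
  refine intervalIntegral.integral_congr fun x _ => ?_
  simp only [← P.op_testCovector hψ u i j x]
  rw [Finset.sum_eq_single i]
  · simp [testCovector]
  · intro k _ hk
    simp [testCovector, hk]
  · simp

/-- The variational derivative of `{∫ φ uⁱ, ∫ ψ uʲ}` at the constant loop `u₀`. -/
def bracketGrad (u₀ : Coord n) (φ ψ : ℝ → ℝ) (i j : Fin n) (x : ℝ) : Coord n :=
  WithLp.toLp 2 fun k =>
    pd k (fun u => P.a u i j) u₀ * (φ x * deriv (deriv ψ) x)
      - P.b i j k u₀ * (deriv φ x * deriv ψ x + φ x * deriv (deriv ψ) x)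
      + P.c i j k u₀ * (deriv (deriv φ) x * ψ x + 2 * (deriv φ x * deriv ψ x)
        + φ x * deriv (deriv ψ) x)

theorem isLoop_const {U : Set (Coord n)} {u₀ : Coord n} (hu : u₀ ∈ U) :
    IsLoop U fun _ => u₀ :=
  ⟨contDiff_const, fun _ => rfl, fun _ => hu⟩

end Coeffs

theorem fderiv_apply_eq_sum_pd (f : Coord n → ℝ) (u v : Coord n) :
    fderiv ℝ f u v = ∑ k, pd k f u * v k := by
  have hv : v = ∑ k, v k • EuclideanSpace.single k (1 : ℝ) := by
    ext i
    simp [Finset.sum_apply, Pi.single_apply]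
  conv_lhs => rw [hv]
  rw [map_sum]
  refine Finset.sum_congr rfl fun k _ => ?_
  rw [map_smul, smul_eq_mul, mul_comm]
  rfl

namespace Coeffs

variable (P : Coeffs n)

theorem isLoop_bracketGrad (u₀ : Coord n) {φ ψ : ℝ → ℝ} (hφ : IsCircleFun φ)
    (hψ : IsCircleFun ψ) (i j : Fin n) : IsLoop univ (P.bracketGrad u₀ φ ψ i j) :=
  isLoop_toLp fun _ =>
    (((hφ.mul hψ.deriv.deriv).const_mul _).sub
      (((hφ.deriv.mul hψ.deriv).add (hφ.mul hψ.deriv.deriv)).const_mul _)).add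
      ((((hφ.deriv.deriv.mul hψ).add ((hφ.deriv.mul hψ.deriv).const_mul 2)).add
        (hφ.mul hψ.deriv.deriv)).const_mul _)

/-- Integration by parts on the circle. -/
theorem integral_circle_by_parts {φ ψ η : ℝ → ℝ} (hφ : IsCircleFun φ) (hψ : IsCircleFun ψ)
    (hη : IsCircleFun η) (α β γ : ℝ) :
    ∫ x in (0 : ℝ)..1, (α * (φ x * deriv (deriv ψ) x)
      - β * (deriv φ x * deriv ψ x + φ x * deriv (deriv ψ) x)
      + γ * (deriv (deriv φ) x * ψ x + 2 * (deriv φ x * deriv ψ x)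
        + φ x * deriv (deriv ψ) x)) * η x =
    ∫ x in (0 : ℝ)..1, φ x * (α * η x * deriv (deriv ψ) x + β * deriv η x * deriv ψ x
      + γ * deriv (deriv η) x * ψ x) := by
  have c1 := hφ.smooth.continuous
  have c2 := hψ.smooth.continuous
  have c3 := hφ.deriv.smooth.continuous
  have c4 := hψ.deriv.smooth.continuous
  have c5 := hφ.deriv.deriv.smooth.continuous
  have c6 := hψ.deriv.deriv.smooth.continuous
  have c7 := hη.smooth.continuous
  have c8 := hη.deriv.smooth.continuous
  have c9 := hη.deriv.deriv.smooth.continuous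
  rw [← sub_eq_zero, ← intervalIntegral.integral_sub
    (Continuous.intervalIntegrable (by fun_prop) _ _)
    (Continuous.intervalIntegrable (by fun_prop) _ _)]
  -- The difference of the two integrands is the derivative of this periodic expression: γ((φψ)'η -
  -- φψη') moves two derivatives, βφψ'η moves one.
  refine integral_eq_zero_of_periodic
    (f := fun x => γ * ((deriv φ x * ψ x + φ x * deriv ψ x) * η x - φ x * ψ x * deriv η x)
      - β * (φ x * deriv ψ x * η x)) (fun x => ?_) (fun x => ?_) (by fun_prop)
  · simp only [hφ.periodic x, hψ.periodic x, hφ.deriv.periodic x, hψ.deriv.periodic x,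
      hη.periodic x, hη.deriv.periodic x]
  · have d1 := hφ.hasDerivAt x
    have d2 := hψ.hasDerivAt x
    have d3 := hφ.deriv.hasDerivAt x
    have d4 := hψ.deriv.hasDerivAt x
    have d5 := hη.hasDerivAt x
    have d6 := hη.deriv.hasDerivAt x
    refine (((((d3.fun_mul d2).fun_add (d1.fun_mul d4)).fun_mul d5).fun_sub
      ((d1.fun_mul d2).fun_mul d6)).const_mul γ |>.fun_sub
        (((d1.fun_mul d4).fun_mul d5).const_mul β)).congr_deriv ?_
    ring

/-- Integration by parts against the linearization of `{∫ φ uⁱ, ∫ ψ uʲ}` at a constant loop. -/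
theorem integral_bracketGrad (u₀ : Coord n) {φ ψ : ℝ → ℝ} (hφ : IsCircleFun φ)
    (hψ : IsCircleFun ψ) (i j : Fin n) {v : ℝ → Coord n} (hv : IsLoop univ v) :
    ∫ x in (0 : ℝ)..1, ∑ k, P.bracketGrad u₀ φ ψ i j x k * v x k =
      ∫ x in (0 : ℝ)..1, φ x * ((∑ k, pd k (fun u => P.a u i j) u₀ * v x k) * deriv (deriv ψ) x
        + (∑ k, P.b i j k u₀ * deriv v x k) * deriv ψ x
        + (∑ k, P.c i j k u₀ * iteratedDeriv 2 v x k) * ψ x) := by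
  have hvk := hv.coord
  have e1 : ∀ x k, deriv v x k = deriv (fun y => v y k) x :=
    fun x k => deriv_coord (hv.1.differentiable (by simp) x) k
  have e2 : ∀ x k, iteratedDeriv 2 v x k = deriv (deriv fun y => v y k) x :=
    fun x k => iteratedDeriv_two_coord hv k x
  have c1 := hφ.smooth.continuous
  have c2 := hψ.smooth.continuous
  have c4 := hψ.deriv.smooth.continuous
  have c6 := hψ.deriv.deriv.smooth.continuous
  have c7 := fun k => (hvk k).smooth.continuous
  have c8 := fun k => (hvk k).deriv.smooth.continuous
  have c9 := fun k => (hvk k).deriv.deriv.smooth.continuous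
  have hg := fun k => ((P.isLoop_bracketGrad u₀ hφ hψ i j).coord k).smooth.continuous
  rw [intervalIntegral.integral_finsetSum
    (f := fun k x => P.bracketGrad u₀ φ ψ i j x k * v x k) fun k _ =>
    ((hg k).mul (c7 k)).intervalIntegrable _ _]
  simp only [bracketGrad]
  rw [Finset.sum_congr rfl fun k _ => integral_circle_by_parts hφ hψ (hvk k) _ _ _]
  refine (intervalIntegral.integral_finsetSum (f := fun k x => φ x *
    (pd k (fun u => P.a u i j) u₀ * v x k * deriv (deriv ψ) x
      + P.b i j k u₀ * deriv (fun x => v x k) x * deriv ψ x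
      + P.c i j k u₀ * deriv (deriv fun x => v x k) x * ψ x)) fun k _ =>
      (c1.mul ((((continuous_const.mul (c7 k)).mul c6).add
        ((continuous_const.mul (c8 k)).mul c4)).add
          ((continuous_const.mul (c9 k)).mul c2))).intervalIntegrable _ _).symm.trans ?_
  refine intervalIntegral.integral_congr fun x _ => ?_
  simp only [e1, e2, Finset.mul_sum, Finset.sum_mul, ← Finset.sum_add_distrib]

theorem hasDerivAt_mul_id_mul {β : ℝ → ℝ} (hβ : DifferentiableAt ℝ β 0) (d : ℝ) :
    HasDerivAt (fun ε => β ε * (ε * d)) (β 0 * d) 0 := by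
  simpa using hβ.hasDerivAt.fun_mul ((hasDerivAt_id (0 : ℝ)).mul_const d)

theorem hasDerivAt_mul_id_mul_mul {β : ℝ → ℝ} (hβ : DifferentiableAt ℝ β 0) (d e : ℝ) :
    HasDerivAt (fun ε => β ε * (ε * d) * (ε * e)) 0 0 := by
  simpa using (hasDerivAt_mul_id_mul hβ d).fun_mul ((hasDerivAt_id (0 : ℝ)).mul_const e)

/-- The variational derivative of the bracket of two linear functionals at a constant loop. -/
theorem hasVarDerivAt_bracket {U : Set (Coord n)} (hU : IsOpen U) (hP : P.IsAdmissible U)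
    {u₀ : Coord n} (hu : u₀ ∈ U) {φ ψ : ℝ → ℝ} (hφ : IsCircleFun φ) (hψ : IsCircleFun ψ)
    (i j : Fin n) :
    HasVarDerivAt (P.bracket (linFun φ i) (linFun ψ j)) (fun _ => u₀)
      (P.bracketGrad u₀ φ ψ i j) := by
  refine ⟨P.isLoop_bracketGrad u₀ hφ hψ i j, fun v hv => ?_⟩
  rw [P.integral_bracketGrad u₀ hφ hψ i j hv]
  -- Only smoothness and periodicity of the perturbed loop matter for the bracket formula, so `univ`
  -- suffices here for every ε.
  have hpert : ∀ ε : ℝ, IsLoop univ ((fun _ => u₀) + ε • v) := fun ε =>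
    ⟨contDiff_const.add (contDiff_const.smul hv.1),
      fun x => by simp only [Pi.add_apply, Pi.smul_apply, hv.2.1 x], fun _ => mem_univ _⟩
  have hcoord : ∀ (ε : ℝ) k, (fun y => ((fun _ => u₀) + ε • v : ℝ → Coord n) y k) =
      fun y => u₀ k + ε * v y k := fun ε k => rfl
  have p1 : ∀ (ε : ℝ) x k, deriv ((fun _ => u₀) + ε • v : ℝ → Coord n) x k = ε * deriv v x k := by
    intro ε x k
    rw [deriv_coord ((hpert ε).1.differentiable (by simp) x), hcoord,
      deriv_coord (hv.1.differentiable (by simp) x)]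
    simp
  have p2 : ∀ (ε : ℝ) x k, iteratedDeriv 2 ((fun _ => u₀) + ε • v : ℝ → Coord n) x k =
      ε * iteratedDeriv 2 v x k := by
    intro ε x k
    rw [iteratedDeriv_two_coord (hpert ε), hcoord, iteratedDeriv_two_coord hv]
    simp
  let S : ℝ × ℝ → Coord n := fun z => u₀ + z.1 • v z.2
  let Φ : ℝ × ℝ → ℝ := fun z => φ z.2 * (P.a (S z) i j * deriv (deriv ψ) z.2
        + (∑ k, P.b i j k (S z) * (z.1 * deriv v z.2 k)) * deriv ψ z.2
        + ((∑ k, ∑ l, P.cc i j k l (S z) * (z.1 * deriv v z.2 k) * (z.1 * deriv v z.2 l))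
          + ∑ k, P.c i j k (S z) * (z.1 * iteratedDeriv 2 v z.2 k)) * ψ z.2)
  have hE : (fun ε : ℝ => P.bracket (linFun φ i) (linFun ψ j) ((fun _ => u₀) + ε • v)) =
      fun ε => ∫ x in (0 : ℝ)..1, Φ (ε, x) := by
    funext ε
    rw [P.bracket_linFun hφ hψ i j (hpert ε)]
    refine intervalIntegral.integral_congr fun x _ => ?_
    simp only [p1, p2, Φ, S]
    rfl
  rw [hE]
  have hS : ContDiff ℝ ∞ S := contDiff_const.add (contDiff_fst.smul (hv.1.comp contDiff_snd))
  have hS0 : ∀ x, S (0, x) = u₀ := fun x => by simp [S]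
  have hv1 : ∀ k, ContDiff ℝ ∞ fun z : ℝ × ℝ => deriv v z.2 k := fun k =>
    (EuclideanSpace.proj (𝕜 := ℝ) k).contDiff.comp
      ((hv.1.deriv' (n := ∞)).comp contDiff_snd)
  have hv2 : ∀ k, ContDiff ℝ ∞ fun z : ℝ × ℝ => iteratedDeriv 2 v z.2 k := fun k => by
    simp only [iteratedDeriv_two_coord hv]
    exact (hv.coord k).deriv.deriv.smooth.comp contDiff_snd
  have hcomp : ∀ f : Coord n → ℝ, ContDiffOn ℝ ∞ f U →
      ContDiffOn ℝ ∞ (fun z => f (S z)) (S ⁻¹' U) := fun f hf =>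
    hf.comp hS.contDiffOn fun z hz => hz
  have hf : ∀ (f : Coord n → ℝ), ContDiffOn ℝ ∞ f U → ∀ x,
      HasDerivAt (fun ε => f (S (ε, x))) (∑ k, pd k f u₀ * v x k) 0 := by
    intro f hf x
    have h1 : HasFDerivAt f (fderiv ℝ f u₀) (S (0, x)) := by
      rw [hS0]
      exact ((hf.differentiableOn (by simp)).differentiableAt (hU.mem_nhds hu)).hasFDerivAt
    have h2 : HasDerivAt (fun ε => S (ε, x)) (v x) 0 := by
      simpa [S] using ((hasDerivAt_id (0 : ℝ)).smul_const (v x)).const_add u₀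
    rw [← fderiv_apply_eq_sum_pd]
    exact h1.comp_hasDerivAt 0 h2
  -- The coefficients are smooth only on U, so the integrand is smooth on the open set of (ε, x)
  -- with u₀ + ε v(x) ∈ U, which contains the line ε = 0.
  refine hasDerivAt_intervalIntegral_of_contDiffOn (hU.preimage hS.continuous)
    (fun x => by simpa [hS0] using hu) (Φ := Φ) (ContDiffOn.of_le (n := ∞) ?_ (by simp)) ?_
  · have s1 : ContDiff ℝ ∞ fun z : ℝ × ℝ => z.1 := contDiff_fst
    refine (hφ.smooth.comp contDiff_snd).contDiffOn.mul (((ContDiffOn.mul ?_ ?_).add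
      (ContDiffOn.mul ?_ ?_)).add (ContDiffOn.mul (ContDiffOn.add ?_ ?_) ?_))
    · exact hcomp _ (hP.smooth_a i j)
    · exact (hψ.deriv.deriv.smooth.comp contDiff_snd).contDiffOn
    · exact ContDiffOn.sum fun k _ => (hcomp _ (hP.smooth_b i j k)).mul (s1.mul (hv1 k)).contDiffOn
    · exact (hψ.deriv.smooth.comp contDiff_snd).contDiffOn
    · exact ContDiffOn.sum fun k _ => ContDiffOn.sum fun l _ =>
        ((hcomp _ (hP.smooth_cc i j k l)).mul (s1.mul (hv1 k)).contDiffOn).mul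
          (s1.mul (hv1 l)).contDiffOn
    · exact ContDiffOn.sum fun k _ => (hcomp _ (hP.smooth_c i j k)).mul (s1.mul (hv2 k)).contDiffOn
    · exact (hψ.smooth.comp contDiff_snd).contDiffOn
  · intro x
    simp only [Φ]
    refine HasDerivAt.const_mul _ (((hf _ (hP.smooth_a i j) x).mul_const _).fun_add
      (HasDerivAt.mul_const ?_ _) |>.fun_add (HasDerivAt.mul_const ?_ _))
    · refine HasDerivAt.fun_sum fun k _ => ?_
      have := hasDerivAt_mul_id_mul (hf _ (hP.smooth_b i j k) x).differentiableAt (deriv v x k)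
      simpa only [hS0] using this
    · rw [← zero_add (∑ k, P.c i j k u₀ * _)]
      refine HasDerivAt.fun_add ?_ (HasDerivAt.fun_sum fun k _ => ?_)
      -- The terms with two first derivatives of u carry ε², so they contribute nothing at ε = 0.
      · have := HasDerivAt.fun_sum (u := Finset.univ) fun k (_ : k ∈ Finset.univ) =>
          HasDerivAt.fun_sum (u := Finset.univ) fun l (_ : l ∈ Finset.univ) =>
            hasDerivAt_mul_id_mul_mul (hf _ (hP.smooth_cc i j k l) x).differentiableAt
              (deriv v x k) (deriv v x l)
        simpa only [Finset.sum_const_zero] using this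
      · have := hasDerivAt_mul_id_mul (hf _ (hP.smooth_c i j k) x).differentiableAt
          (iteratedDeriv 2 v x k)
        simpa only [hS0] using this

end Coeffs

/-! ### Cosine modes and their integrals -/

/-- The mode `x ↦ cos (2πmx)`. -/
def cosMode (m : ℕ) (x : ℝ) : ℝ := Real.cos (m * (2 * Real.pi * x))

theorem isCircleFun_cosMode (m : ℕ) : IsCircleFun (cosMode m) := by
  refine ⟨?_, fun x => ?_⟩
  · unfold cosMode
    exact Real.contDiff_cos.comp (by fun_prop)
  · have h := Real.cos_add_nat_mul_two_pi (m * (2 * Real.pi * x)) m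
    rw [cosMode, cosMode, ← h]
    congr 1
    ring

theorem isCircleFun_one : IsCircleFun fun _ => (1 : ℝ) :=
  ⟨contDiff_const, fun _ => rfl⟩

theorem deriv_cosMode (m : ℕ) :
    deriv (cosMode m) = fun x => -(m * (2 * Real.pi)) * Real.sin (m * (2 * Real.pi * x)) := by
  funext x
  have h : HasDerivAt (fun x : ℝ => (m : ℝ) * (2 * Real.pi * x)) (m * (2 * Real.pi)) x := by
    simpa using ((hasDerivAt_id x).const_mul (2 * Real.pi)).const_mul (m : ℝ)
  refine ((Real.hasDerivAt_cos _).comp x h).deriv.trans ?_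
  ring

theorem deriv_deriv_cosMode (m : ℕ) :
    deriv (deriv (cosMode m)) = fun x => -(m * (2 * Real.pi)) ^ 2 * cosMode m x := by
  funext x
  have h : HasDerivAt (fun x : ℝ => (m : ℝ) * (2 * Real.pi * x)) (m * (2 * Real.pi)) x := by
    simpa using ((hasDerivAt_id x).const_mul (2 * Real.pi)).const_mul (m : ℝ)
  rw [deriv_cosMode]
  refine (((Real.hasDerivAt_sin _).comp x h).const_mul _).deriv.trans ?_
  rw [cosMode]
  ring

/-- For m ≠ 0 the mode is a nonzero multiple of its own second derivative, and the derivative of a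
periodic function integrates to zero. -/
theorem integral_cosMode {m : ℕ} (hm : m ≠ 0) : ∫ x in (0 : ℝ)..1, cosMode m x = 0 := by
  have hc : (m * (2 * Real.pi) : ℝ) ≠ 0 := by positivity
  have h := integral_eq_zero_of_periodic (isCircleFun_cosMode m).deriv.periodic
    (isCircleFun_cosMode m).deriv.hasDerivAt (isCircleFun_cosMode m).deriv.deriv.smooth.continuous
  rw [deriv_deriv_cosMode, intervalIntegral.integral_const_mul] at h
  exact (mul_eq_zero.1 h).resolve_left (neg_ne_zero.2 (pow_ne_zero 2 hc))

/-- Reads off the mean of a Fourier expansion; modes 0, 2 and 4 are all that occur in the products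
below. -/
theorem integral_add_cosMode (A B C : ℝ) :
    ∫ x in (0 : ℝ)..1, (A + B * cosMode 2 x + C * cosMode 4 x) = A := by
  have c := fun m => (isCircleFun_cosMode m).smooth.continuous
  have c2 := c 2
  have c4 := c 4
  rw [intervalIntegral.integral_add (Continuous.intervalIntegrable (by fun_prop) _ _)
      (Continuous.intervalIntegrable (by fun_prop) _ _),
    intervalIntegral.integral_add (Continuous.intervalIntegrable (by fun_prop) _ _)
      (Continuous.intervalIntegrable (by fun_prop) _ _),
    intervalIntegral.integral_const_mul, intervalIntegral.integral_const_mul,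
    integral_cosMode two_ne_zero, integral_cosMode four_ne_zero]
  simp

/-- Rewriting the modes as polynomials in `cosMode 1` turns the trigonometric identities below into
goals for `ring`. -/
theorem cosMode_two (x : ℝ) : cosMode 2 x = 2 * cosMode 1 x ^ 2 - 1 := by
  simp only [cosMode, Nat.cast_ofNat, Nat.cast_one, one_mul]
  exact Real.cos_two_mul _

theorem cosMode_four (x : ℝ) : cosMode 4 x = 2 * (2 * cosMode 1 x ^ 2 - 1) ^ 2 - 1 := by
  rw [← cosMode_two]
  simp only [cosMode, Nat.cast_ofNat]
  rw [← Real.cos_two_mul]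
  congr 1
  ring

/-- Small perturbations of a constant loop stay in an open set. -/
theorem eventually_isLoop_add_smul {U : Set (Coord n)} (hU : IsOpen U) {u₀ : Coord n}
    (hu : u₀ ∈ U) {v : ℝ → Coord n} (hv : IsLoop univ v) :
    ∀ᶠ ε : ℝ in 𝓝 0, IsLoop U ((fun _ => u₀) + ε • v) := by
  obtain ⟨r, hr, hrU⟩ := Metric.isOpen_iff.1 hU u₀ hu
  obtain ⟨C, hC⟩ := (hv.2.1.compact_of_continuous one_ne_zero
    hv.1.continuous).isBounded.exists_norm_le
  have hC0 : 0 ≤ C := (norm_nonneg _).trans (hC _ (mem_range_self 0))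
  filter_upwards [Metric.ball_mem_nhds (0 : ℝ) (div_pos hr (by linarith : 0 < C + 1))] with ε hε
  refine ⟨contDiff_const.add (contDiff_const.smul hv.1),
    fun x => by simp only [Pi.add_apply, Pi.smul_apply, hv.2.1 x], fun x => hrU ?_⟩
  rw [mem_ball_zero_iff] at hε
  rw [mem_ball_iff_norm]
  simp only [Pi.add_apply, Pi.smul_apply, add_sub_cancel_left, norm_smul]
  calc ‖ε‖ * ‖v x‖ ≤ ‖ε‖ * (C + 1) :=
        mul_le_mul_of_nonneg_left ((hC _ (mem_range_self x)).trans (by linarith)) (norm_nonneg _)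
    _ < r := (lt_div_iff₀ (by linarith)).1 hε

/-! ### Relations between a, b and c forced by the Hamiltonian property -/

namespace Coeffs

variable {P : Coeffs n} {U : Set (Coord n)} {u₀ : Coord n}

theorem bracket_linFun_const {φ ψ : ℝ → ℝ} (hφ : IsCircleFun φ) (hψ : IsCircleFun ψ)
    (i j : Fin n) :
    P.bracket (linFun φ i) (linFun ψ j) (fun _ => u₀) =
      ∫ x in (0 : ℝ)..1, φ x * (P.a u₀ i j * deriv (deriv ψ) x) := by
  rw [P.bracket_linFun hφ hψ i j (isLoop_const (mem_univ u₀))]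
  have h2 : ∀ x, iteratedDeriv 2 (fun _ : ℝ => u₀) x = 0 := fun x => by
    simp [iteratedDeriv_const]
  refine intervalIntegral.integral_congr fun x _ => ?_
  simp [h2]

/-- `aⁱʲ` is skew-symmetric. -/
theorem IsHamiltonianOn.a_antisymm (h : P.IsHamiltonianOn U) (hu : u₀ ∈ U) (i j : Fin n) :
    P.a u₀ i j = -P.a u₀ j i := by
  have hc := isCircleFun_cosMode 1
  have e := h.1 _ _ (isLocalFunctional_linFun U hc i) (isLocalFunctional_linFun U hc j) _
    (isLoop_const hu)
  have val : ∀ s : ℝ, ∫ x in (0 : ℝ)..1, cosMode 1 x * (s * deriv (deriv (cosMode 1)) x) =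
      -(2 * Real.pi) ^ 2 * s / 2 := by
    intro s
    rw [← integral_add_cosMode (-(2 * Real.pi) ^ 2 * s / 2) (-(2 * Real.pi) ^ 2 * s / 2) 0]
    refine intervalIntegral.integral_congr fun x _ => ?_
    simp only [deriv_deriv_cosMode, cosMode_two, Nat.cast_one]
    ring
  rw [bracket_linFun_const hc hc, bracket_linFun_const hc hc, val, val] at e
  have hpi : (2 * Real.pi) ^ 2 ≠ 0 := by positivity
  apply mul_left_cancel₀ hpi
  linarith

/-- The skew-symmetry relation between `∂ₖaⁱʲ`, `bⁱʲₖ` and `cⁱʲₖ`. -/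
theorem IsHamiltonianOn.pd_a (h : P.IsHamiltonianOn U) (hU : IsOpen U) (hP : P.IsAdmissible U)
    (hu : u₀ ∈ U) (i j k : Fin n) :
    pd k (fun u => P.a u i j) u₀ = P.b i j k u₀ - P.c i j k u₀ - P.c j i k u₀ := by
  have h1 := isCircleFun_one
  have hc := isCircleFun_cosMode 1
  have e1 := P.hasVarDerivAt_bracket hU hP hu h1 hc i j
  have e2 := P.hasVarDerivAt_bracket hU hP hu hc h1 j i
  -- Skew-symmetry is known only for loops in U; small perturbations of the constant loop stay
  -- there, so it passes to the variational derivatives. By uniqueness the two gradients agree, and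
  -- they are compared at x = 0, where the cosine is 1 and its derivative is 0.
  have e3 : HasVarDerivAt (P.bracket (linFun (fun _ => 1) i) (linFun (cosMode 1) j)) (fun _ => u₀)
      (-P.bracketGrad u₀ (cosMode 1) (fun _ => 1) j i) := by
    refine ⟨⟨e2.1.1.neg, fun x => congrArg Neg.neg (e2.1.2.1 x), fun _ => mem_univ _⟩, fun v hv => ?_⟩
    have := (e2.2 v hv).neg
    simp only [Pi.neg_apply, PiLp.neg_apply, neg_mul, Finset.sum_neg_distrib,
      intervalIntegral.integral_neg]
    refine this.congr_of_eventuallyEq ?_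
    filter_upwards [eventually_isLoop_add_smul hU hu hv] with ε hε
    exact h.1 _ _ (isLocalFunctional_linFun U h1 i) (isLocalFunctional_linFun U hc j) _ hε
  have e := congrArg (fun w : ℝ → Coord n => w 0 k) (e1.unique e3)
  have hz2 : deriv (fun _ : ℝ => (0 : ℝ)) = fun _ => 0 := funext fun x => deriv_const x 0
  have hz : deriv (fun _ : ℝ => (1 : ℝ)) = fun _ => 0 := funext fun x => deriv_const x 1
  simp only [bracketGrad, Pi.neg_apply, PiLp.neg_apply, hz, hz2, deriv_deriv_cosMode] at e
  simp only [deriv_cosMode, cosMode, Nat.cast_one, mul_zero, Real.cos_zero, Real.sin_zero] at e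
  have hpi : (2 * Real.pi) ^ 2 ≠ 0 := by positivity
  apply mul_left_cancel₀ hpi
  linarith

/-- At a constant loop the operator reduces to aᵏˡ (d/dx)², so the double bracket pairs the gradient
of the inner bracket with aᵏˡ χ''. -/
theorem bracket_bracket_linFun_const (hU : IsOpen U) (hP : P.IsAdmissible U) (hu : u₀ ∈ U)
    {φ ψ χ : ℝ → ℝ} (hφ : IsCircleFun φ) (hψ : IsCircleFun ψ) (hχ : IsCircleFun χ)
    (i j l : Fin n) :
    P.bracket (P.bracket (linFun φ i) (linFun ψ j)) (linFun χ l) (fun _ => u₀) =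
      ∫ x in (0 : ℝ)..1,
        ((∑ k, pd k (fun u => P.a u i j) u₀ * P.a u₀ k l) * (φ x * deriv (deriv ψ) x)
          - (∑ k, P.b i j k u₀ * P.a u₀ k l) *
            (deriv φ x * deriv ψ x + φ x * deriv (deriv ψ) x)
          + (∑ k, P.c i j k u₀ * P.a u₀ k l) *
            (deriv (deriv φ) x * ψ x + 2 * (deriv φ x * deriv ψ x) + φ x * deriv (deriv ψ) x))
        * deriv (deriv χ) x := by
  rw [bracket, (P.hasVarDerivAt_bracket hU hP hu hφ hψ i j).varDeriv_eq,
    (hasVarDerivAt_linFun hχ l (isLoop_const (mem_univ u₀))).varDeriv_eq]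
  have h2 : ∀ x, iteratedDeriv 2 (fun _ : ℝ => u₀) x = 0 := fun x => by
    simp [iteratedDeriv_const]
  refine intervalIntegral.integral_congr fun x _ => ?_
  simp only [P.op_testCovector hχ]
  simp only [bracketGrad, h2, deriv_const, PiLp.zero_apply, mul_zero, Finset.sum_const_zero,
    zero_mul, add_zero, Finset.sum_mul, ← Finset.sum_add_distrib, ← Finset.sum_sub_distrib]
  exact Finset.sum_congr rfl fun k _ => by ring

/-- The first consequence of the Jacobi identity: `cʲˡₖ aᵏⁱ` is symmetric in `i, j`. -/
theorem IsHamiltonianOn.c_symm (h : P.IsHamiltonianOn U) (hU : IsOpen U) (hP : P.IsAdmissible U)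
    (hu : u₀ ∈ U) (i j l : Fin n) :
    ∑ k, P.c j l k u₀ * P.a u₀ k i = ∑ k, P.c i l k u₀ * P.a u₀ k j := by
  have h1 := isCircleFun_one
  have hc := isCircleFun_cosMode 1
  -- Test functions cos, cos, 1. The double bracket with outer function 1 vanishes; the one with
  -- inner pair (cos, 1) keeps only its c-term; in the last, `pd_a` collapses ∂a - b + c to minus
  -- the transposed c.
  have e := h.2 _ _ _ (isLocalFunctional_linFun U hc i) (isLocalFunctional_linFun U hc j)
    (isLocalFunctional_linFun U h1 l) _ (isLoop_const hu)
  rw [bracket_bracket_linFun_const hU hP hu hc hc h1,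
    bracket_bracket_linFun_const hU hP hu hc h1 hc,
    bracket_bracket_linFun_const hU hP hu h1 hc hc] at e
  have hz : deriv (fun _ : ℝ => (1 : ℝ)) = fun _ => 0 := funext fun x => deriv_const x 1
  have hz2 : deriv (fun _ : ℝ => (0 : ℝ)) = fun _ => 0 := funext fun x => deriv_const x 0
  have hsum : ∑ k, pd k (fun u => P.a u l i) u₀ * P.a u₀ k j =
      ∑ k, P.b l i k u₀ * P.a u₀ k j - ∑ k, P.c l i k u₀ * P.a u₀ k j
        - ∑ k, P.c i l k u₀ * P.a u₀ k j := by
    rw [← Finset.sum_sub_distrib, ← Finset.sum_sub_distrib]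
    refine Finset.sum_congr rfl fun k _ => ?_
    rw [h.pd_a hU hP hu]
    ring
  rw [hsum] at e
  generalize (∑ k, P.b l i k u₀ * P.a u₀ k j) = B at e
  generalize (∑ k, P.c l i k u₀ * P.a u₀ k j) = C at e
  generalize (∑ k, P.c i l k u₀ * P.a u₀ k j) = C' at e ⊢
  generalize (∑ k, P.c j l k u₀ * P.a u₀ k i) = C'' at e ⊢
  simp only [hz, hz2, mul_zero, intervalIntegral.integral_zero, zero_add] at e
  have v1 : ∀ s : ℝ, ∫ x in (0 : ℝ)..1,
      s * deriv (deriv (cosMode 1)) x * deriv (deriv (cosMode 1)) x =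
        (2 * Real.pi) ^ 4 * s / 2 := by
    intro s
    rw [← integral_add_cosMode ((2 * Real.pi) ^ 4 * s / 2) ((2 * Real.pi) ^ 4 * s / 2) 0]
    refine intervalIntegral.integral_congr fun x _ => ?_
    simp only [deriv_deriv_cosMode, cosMode_two, Nat.cast_one]
    ring
  have e2 := v1 C''
  have e3 := v1 (-C')
  have hpi : (2 * Real.pi) ^ 4 ≠ 0 := by positivity
  apply mul_left_cancel₀ hpi
  have e4 : (2 * Real.pi) ^ 4 * C'' / 2 + (2 * Real.pi) ^ 4 * -C' / 2 = 0 := by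
    rw [← e2, ← e3]
    refine (congrArg₂ (· + ·) (intervalIntegral.integral_congr fun x _ => ?_)
      (intervalIntegral.integral_congr fun x _ => ?_)).trans e
    · ring
    · ring
  linarith

/-- The second consequence of the Jacobi identity. -/
theorem IsHamiltonianOn.jacobi_cosMode (h : P.IsHamiltonianOn U) (hU : IsOpen U)
    (hP : P.IsAdmissible U) (hu : u₀ ∈ U) (i j l : Fin n) :
    ∑ k, (pd k (fun u => P.a u i j) u₀ + P.b i j k u₀ + P.c i j k u₀) * P.a u₀ k l
      + ∑ k, (4 * pd k (fun u => P.a u j l) u₀ - 8 * P.b j l k u₀ + 16 * P.c j l k u₀)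
        * P.a u₀ k i
      + ∑ k, (4 * pd k (fun u => P.a u l i) u₀ - 2 * P.b l i k u₀ + P.c l i k u₀) * P.a u₀ k j
      = 0 := by
  have hc := isCircleFun_cosMode 1
  have hc2 := isCircleFun_cosMode 2
  -- Modes 2, 1, 1 are resonant: 2 - 1 - 1 = 0. The numbers 4, -8, 16 and so on in the statement are
  -- the symbols of φψ''χ'', -(φψ')'χ'' and (φψ)''χ'' at the frequencies (2, -1, -1), suitably
  -- permuted.
  have e := h.2 _ _ _ (isLocalFunctional_linFun U hc2 i) (isLocalFunctional_linFun U hc j)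
    (isLocalFunctional_linFun U hc l) _ (isLoop_const hu)
  rw [bracket_bracket_linFun_const hU hP hu hc2 hc hc,
    bracket_bracket_linFun_const hU hP hu hc hc hc2,
    bracket_bracket_linFun_const hU hP hu hc hc2 hc] at e
  have expand : ∀ (α β γ δ : Fin n → ℝ) (r s t : ℝ),
      ∑ k, (r * α k + s * β k + t * γ k) * δ k =
        r * ∑ k, α k * δ k + s * ∑ k, β k * δ k + t * ∑ k, γ k * δ k := by
    intro α β γ δ r s t
    simp only [Finset.mul_sum, ← Finset.sum_add_distrib]
    exact Finset.sum_congr rfl fun k _ => by ring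
  have x1 := expand (fun k => pd k (fun u => P.a u i j) u₀) (fun k => P.b i j k u₀)
    (fun k => P.c i j k u₀) (fun k => P.a u₀ k l) 1 1 1
  have x2 := expand (fun k => pd k (fun u => P.a u j l) u₀) (fun k => P.b j l k u₀)
    (fun k => P.c j l k u₀) (fun k => P.a u₀ k i) 4 (-8) 16
  have x3 := expand (fun k => pd k (fun u => P.a u l i) u₀) (fun k => P.b l i k u₀)
    (fun k => P.c l i k u₀) (fun k => P.a u₀ k j) 4 (-2) 1
  simp only [one_mul, neg_mul, ← sub_eq_add_neg] at x1 x2 x3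
  rw [x1, x2, x3]
  generalize (∑ k, pd k (fun u => P.a u i j) u₀ * P.a u₀ k l) = A₁ at e ⊢
  generalize (∑ k, pd k (fun u => P.a u j l) u₀ * P.a u₀ k i) = A₂ at e ⊢
  generalize (∑ k, pd k (fun u => P.a u l i) u₀ * P.a u₀ k j) = A₃ at e ⊢
  generalize (∑ k, P.b i j k u₀ * P.a u₀ k l) = B₁ at e ⊢
  generalize (∑ k, P.b j l k u₀ * P.a u₀ k i) = B₂ at e ⊢
  generalize (∑ k, P.b l i k u₀ * P.a u₀ k j) = B₃ at e ⊢
  generalize (∑ k, P.c i j k u₀ * P.a u₀ k l) = C₁ at e ⊢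
  generalize (∑ k, P.c j l k u₀ * P.a u₀ k i) = C₂ at e ⊢
  generalize (∑ k, P.c l i k u₀ * P.a u₀ k j) = C₃ at e ⊢
  have hsq : ∀ x, Real.sin (2 * Real.pi * x) ^ 2 = 1 - cosMode 1 x ^ 2 := by
    intro x
    simp only [cosMode, Nat.cast_one, one_mul]
    exact Real.sin_sq _
  have hd11 : ∀ x, deriv (cosMode 1) x * deriv (cosMode 1) x =
      (2 * Real.pi) ^ 2 * (1 - cosMode 1 x ^ 2) := by
    intro x
    rw [← hsq]
    simp only [deriv_cosMode, Nat.cast_one, one_mul]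
    ring
  have hd12 : ∀ x, deriv (cosMode 1) x * deriv (cosMode 2) x =
      4 * (2 * Real.pi) ^ 2 * ((1 - cosMode 1 x ^ 2) * cosMode 1 x) := by
    intro x
    rw [← hsq]
    simp only [deriv_cosMode, cosMode, Nat.cast_ofNat, Nat.cast_one, one_mul, Real.sin_two_mul]
    ring
  have hd21 : ∀ x, deriv (cosMode 2) x * deriv (cosMode 1) x =
      4 * (2 * Real.pi) ^ 2 * ((1 - cosMode 1 x ^ 2) * cosMode 1 x) := fun x => by
    rw [mul_comm, hd12]
  have w4 : (2 * Real.pi) ^ 4 / 4 ≠ 0 := by positivity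
  apply mul_left_cancel₀ w4
  rw [mul_zero, ← e, mul_add, mul_add]
  congr 1
  · congr 1
    -- The two explicit coefficients are the Fourier coefficients of the integrand at modes 2 and 4;
    -- only the mean survives.
    · refine (integral_add_cosMode _ ((2 * Real.pi) ^ 4 * (A₁ / 2 - B₁ / 2 + 5 / 2 * C₁))
        ((2 * Real.pi) ^ 4 * (A₁ / 4 - 3 / 4 * B₁ + 9 / 4 * C₁))).symm.trans
          (intervalIntegral.integral_congr fun x _ => ?_)
      simp only [deriv_deriv_cosMode, hd21, cosMode_two, cosMode_four, Nat.cast_one,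
        Nat.cast_ofNat]
      ring
    · refine (integral_add_cosMode _ ((2 * Real.pi) ^ 4 * (2 * A₂))
        ((2 * Real.pi) ^ 4 * (A₂ - 2 * B₂ + 4 * C₂))).symm.trans
          (intervalIntegral.integral_congr fun x _ => ?_)
      simp only [deriv_deriv_cosMode, hd11, cosMode_two, cosMode_four, Nat.cast_one,
        Nat.cast_ofNat]
      ring
  · refine (integral_add_cosMode _ ((2 * Real.pi) ^ 4 * (2 * A₃ - 2 * B₃ + 5 / 2 * C₃))
      ((2 * Real.pi) ^ 4 * (A₃ - 3 / 2 * B₃ + 9 / 4 * C₃))).symm.trans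
        (intervalIntegral.integral_congr fun x _ => ?_)
    simp only [deriv_deriv_cosMode, hd12, cosMode_two, cosMode_four, Nat.cast_one,
      Nat.cast_ofNat]
    ring

end Coeffs

/-! ### The tensor b - 2c: Jacobi equation, ∇a, and the two connections -/

theorem eq_zero_of_sum_mul_eq_zero {A : Matrix (Fin n) (Fin n) ℝ} (hA : A.det ≠ 0)
    {X : Fin n → ℝ} (h : ∀ i, ∑ k, X k * A k i = 0) (k : Fin n) : X k = 0 :=
  congrFun (Matrix.eq_zero_of_vecMul_eq_zero hA (funext h)) k

namespace Coeffs

variable {P : Coeffs n} {U : Set (Coord n)} {u₀ : Coord n}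

theorem IsAdmissible.sum_aLow_mul_a (hP : P.IsAdmissible U) (hu : u₀ ∈ U) (i j : Fin n) :
    ∑ r, P.aLow i r u₀ * P.a u₀ r j = if i = j then 1 else 0 := by
  have h := Matrix.nonsing_inv_mul (P.a u₀) (isUnit_iff_ne_zero.2 (hP.nondegenerate u₀ hu))
  have := congrFun (congrFun h i) j
  rwa [Matrix.mul_apply, Matrix.one_apply] at this

theorem IsAdmissible.sum_a_mul_aLow (hP : P.IsAdmissible U) (hu : u₀ ∈ U) (i j : Fin n) :
    ∑ r, P.a u₀ i r * P.aLow r j u₀ = if i = j then 1 else 0 := by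
  have h := Matrix.mul_nonsing_inv (P.a u₀) (isUnit_iff_ne_zero.2 (hP.nondegenerate u₀ hu))
  have := congrFun (congrFun h i) j
  rwa [Matrix.mul_apply, Matrix.one_apply] at this

theorem IsHamiltonianOn.pd_a_antisymm (h : P.IsHamiltonianOn U) (hU : IsOpen U) (hu : u₀ ∈ U)
    (i j k : Fin n) : pd k (fun u => P.a u i j) u₀ = -pd k (fun u => P.a u j i) u₀ := by
  have e : (fun u => P.a u i j) =ᶠ[𝓝 u₀] fun u => -P.a u j i := by
    filter_upwards [hU.mem_nhds hu] with u hu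
    exact h.a_antisymm hu i j
  rw [pd, e.fderiv_eq, fderiv_fun_neg]
  rfl

/-- The cyclic sum of `∂ₖaⁱʲ aᵏˡ` in terms of the tensor `bⁱʲₖ - 2cⁱʲₖ`. -/
theorem IsHamiltonianOn.cyclic_sum (h : P.IsHamiltonianOn U) (hU : IsOpen U)
    (hP : P.IsAdmissible U) (hu : u₀ ∈ U) (i j l : Fin n) :
    ∑ k, pd k (fun u => P.a u i j) u₀ * P.a u₀ k l
      + ∑ k, pd k (fun u => P.a u j l) u₀ * P.a u₀ k i
      + ∑ k, pd k (fun u => P.a u l i) u₀ * P.a u₀ k j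
      = 3 * ∑ k, (P.b j l k u₀ - 2 * P.c j l k u₀) * P.a u₀ k i := by
  have hb : ∀ i j l, ∑ k, P.b i j k u₀ * P.a u₀ k l =
      ∑ k, pd k (fun u => P.a u i j) u₀ * P.a u₀ k l + ∑ k, P.c i j k u₀ * P.a u₀ k l
        + ∑ k, P.c j i k u₀ * P.a u₀ k l := by
    intro i j l
    simp only [← Finset.sum_add_distrib, ← add_mul]
    refine Finset.sum_congr rfl fun k _ => ?_
    rw [h.pd_a hU hP hu]
    ring
  have hA : ∀ i j l, ∑ k, pd k (fun u => P.a u i j) u₀ * P.a u₀ k l =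
      -∑ k, pd k (fun u => P.a u j i) u₀ * P.a u₀ k l := by
    intro i j l
    rw [← Finset.sum_neg_distrib]
    refine Finset.sum_congr rfl fun k _ => ?_
    rw [h.pd_a_antisymm hU hu, neg_mul]
  have hC := h.c_symm hU hP hu
  have hJ := h.jacobi_cosMode hU hP hu i j l
  simp only [add_mul, sub_mul, Finset.sum_add_distrib, Finset.sum_sub_distrib, mul_assoc,
    ← Finset.mul_sum, hb] at hJ ⊢
  -- These three instances identify the six contractions of c in pairs, according to the middle
  -- index. What remains is linear in three contractions of ∂a and three of c.
  have := hC i j l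
  have := hC j l i
  have := hC l i j
  linarith

/-- The Jacobi equation for `aⁱʲ` is equivalent to `b = 2c`. -/
theorem IsHamiltonianOn.jacobiEqOn_iff (h : P.IsHamiltonianOn U) (hU : IsOpen U)
    (hP : P.IsAdmissible U) :
    P.JacobiEqOn U ↔ ∀ u ∈ U, ∀ i j k, P.b i j k u = 2 * P.c i j k u := by
  have key : ∀ u ∈ U, ∀ i j k,
      ∑ r, (P.a u i r * pd r (fun u => P.a u j k) u + P.a u j r * pd r (fun u => P.a u k i) u
        + P.a u k r * pd r (fun u => P.a u i j) u)
      = -(3 * ∑ r, (P.b j k r u - 2 * P.c j k r u) * P.a u r i) := by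
    intro u hu i j k
    rw [← h.cyclic_sum hU hP hu i j k]
    simp only [← Finset.sum_add_distrib, ← Finset.sum_neg_distrib]
    refine Finset.sum_congr rfl fun r _ => ?_
    -- The Jacobi equation contracts a on its second index and `cyclic_sum` on its first; this is
    -- the source of the minus sign.
    rw [h.a_antisymm hu i r, h.a_antisymm hu j r, h.a_antisymm hu k r]
    ring
  constructor
  · intro hJ u hu i j k
    have := eq_zero_of_sum_mul_eq_zero (hP.nondegenerate u hu)
      (X := fun r => P.b i j r u - 2 * P.c i j r u) (fun l => by
        have := hJ u hu l i j
        rw [key u hu] at this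
        linarith) k
    linarith
  · intro hbc u hu i j k
    rw [key u hu]
    simp [hbc u hu]

/-- `∇ₖaⁱʲ = bⁱʲₖ - 2cⁱʲₖ`. -/
theorem IsHamiltonianOn.nablaUp_eq (h : P.IsHamiltonianOn U) (hU : IsOpen U)
    (hP : P.IsAdmissible U) (hu : u₀ ∈ U) (k i j : Fin n) :
    P.nablaUp k i j u₀ = P.b i j k u₀ - 2 * P.c i j k u₀ := by
  -- The symmetry `c_symm` moves the free index j into c, after which a meets its inverse; the sign
  -- in the definition of Γ cancels against the antisymmetry of a.
  have hG : ∀ i j, ∑ r, P.Gam i k r u₀ * P.a u₀ r j = P.c j i k u₀ := by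
    intro i j
    calc ∑ r, P.Gam i k r u₀ * P.a u₀ r j
        = -∑ s, P.aLow k s u₀ * ∑ r, P.c s i r u₀ * P.a u₀ r j := by
          simp only [Gam, neg_mul, Finset.sum_neg_distrib, Finset.sum_mul, Finset.mul_sum]
          rw [Finset.sum_comm]
          simp only [mul_assoc]
      _ = -∑ s, P.aLow k s u₀ * ∑ r, P.c j i r u₀ * P.a u₀ r s := by
          simp only [h.c_symm hU hP hu j _ i]
      _ = ∑ r, P.c j i r u₀ * ∑ s, P.aLow k s u₀ * P.a u₀ s r := by
          simp only [Finset.mul_sum, ← Finset.sum_neg_distrib]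
          rw [Finset.sum_comm]
          refine Finset.sum_congr rfl fun r _ => Finset.sum_congr rfl fun s _ => ?_
          rw [h.a_antisymm hu r s]
          ring
      _ = P.c j i k u₀ := by
          simp [hP.sum_aLow_mul_a hu]
  have hG' : ∑ r, P.Gam j k r u₀ * P.a u₀ i r = -P.c i j k u₀ := by
    rw [← hG j i, ← Finset.sum_neg_distrib]
    refine Finset.sum_congr rfl fun r _ => ?_
    rw [h.a_antisymm hu i r, mul_neg]
  rw [nablaUp, hG, hG', h.pd_a hU hP hu]
  ring

/-- `b = 2c` if and only if the two connections coincide. -/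
theorem IsAdmissible.b_eq_iff (hP : P.IsAdmissible U) (hu : u₀ ∈ U) :
    (∀ i j k, P.b i j k u₀ = 2 * P.c i j k u₀) ↔ ∀ k i j, P.Gam k i j u₀ = P.GamBar k i j u₀ := by
  constructor
  · intro h k i j
    simp only [Gam, GamBar, h, Finset.mul_sum, ← Finset.sum_neg_distrib]
    exact Finset.sum_congr rfl fun r _ => by ring
  · intro h i j k
    have e : ∀ l, ∑ r, P.aLow l r u₀ * (P.b r j k u₀ - 2 * P.c r j k u₀) = 0 := by
      intro l
      have := h j l k
      simp only [Gam, GamBar] at this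
      simp only [mul_sub, Finset.sum_sub_distrib, mul_left_comm _ (2 : ℝ), ← Finset.mul_sum]
      linarith
    have e2 : ∑ l, P.a u₀ i l * ∑ r, P.aLow l r u₀ * (P.b r j k u₀ - 2 * P.c r j k u₀) =
        P.b i j k u₀ - 2 * P.c i j k u₀ := by
      simp only [Finset.mul_sum, ← mul_assoc]
      rw [Finset.sum_comm]
      simp only [← Finset.sum_mul, hP.sum_a_mul_aLow hu]
      simp
    simp only [e, mul_zero, Finset.sum_const_zero] at e2
    linarith

end Coeffs

/-! ### Smoothness of the inverse matrix; rules for partial derivatives -/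

theorem contDiffOn_matrix_det {E : Type*} [NormedAddCommGroup E] [NormedSpace ℝ E] {s : Set E}
    {A : E → Matrix (Fin n) (Fin n) ℝ} (hA : ∀ i j, ContDiffOn ℝ ∞ (fun u => A u i j) s) :
    ContDiffOn ℝ ∞ (fun u => (A u).det) s := by
  simp only [Matrix.det_apply']
  exact ContDiffOn.sum fun σ _ => contDiffOn_const.mul (contDiffOn_prod fun i _ => hA _ _)

/-- Cramer's rule: each entry is a cofactor over the determinant, and a cofactor is the determinant
of A with one row replaced by a constant row. -/
theorem contDiffOn_matrix_inv {E : Type*} [NormedAddCommGroup E] [NormedSpace ℝ E] {s : Set E}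
    {A : E → Matrix (Fin n) (Fin n) ℝ} (hA : ∀ i j, ContDiffOn ℝ ∞ (fun u => A u i j) s)
    (hdet : ∀ u ∈ s, (A u).det ≠ 0) (i j : Fin n) :
    ContDiffOn ℝ ∞ (fun u => (A u)⁻¹ i j) s := by
  simp only [Matrix.inv_def, Ring.inverse_eq_inv', Matrix.smul_apply, smul_eq_mul,
    Matrix.adjugate_apply]
  refine ((contDiffOn_matrix_det hA).inv hdet).mul (contDiffOn_matrix_det fun k l => ?_)
  by_cases h : k = j
  · subst h
    simpa using contDiffOn_const
  · simpa [Matrix.updateRow_ne h] using hA k l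

section PartialDerivatives

variable {U : Set (Coord n)} {f g : Coord n → ℝ} {u : Coord n}

theorem pd_congr (h : f =ᶠ[𝓝 u] g) (k : Fin n) : pd k f u = pd k g u := by
  rw [pd, h.fderiv_eq, pd]

theorem pd_mul (hf : DifferentiableAt ℝ f u) (hg : DifferentiableAt ℝ g u) (k : Fin n) :
    pd k (fun u => f u * g u) u = f u * pd k g u + g u * pd k f u := by
  simp [pd, fderiv_fun_mul hf hg]

theorem pd_sum {ι : Type*} {s : Finset ι} {F : ι → Coord n → ℝ}
    (hF : ∀ i ∈ s, DifferentiableAt ℝ (F i) u) (k : Fin n) :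
    pd k (fun u => ∑ i ∈ s, F i u) u = ∑ i ∈ s, pd k (F i) u := by
  simp [pd, fderiv_fun_sum hF]

theorem pd_const (c : ℝ) (k : Fin n) : pd k (fun _ => c) u = 0 := by
  simp [pd]

theorem pd_coord (i k : Fin n) (u : Coord n) :
    pd k (fun u => u i) u = if k = i then 1 else 0 := by
  have h : HasFDerivAt (fun u : Coord n => u i) (EuclideanSpace.proj (𝕜 := ℝ) i) u :=
    (EuclideanSpace.proj (𝕜 := ℝ) i).hasFDerivAt
  rw [pd, h.fderiv]
  simp [eq_comm]

theorem contDiffOn_pd (hU : IsOpen U) (hf : ContDiffOn ℝ ∞ f U) (k : Fin n) :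
    ContDiffOn ℝ ∞ (pd k f) U :=
  (hf.fderiv_of_isOpen hU (m := ∞) (by simp)).clm_apply contDiffOn_const

theorem pd_comm (hU : IsOpen U) (hf : ContDiffOn ℝ ∞ f U) (hu : u ∈ U) (k l : Fin n) :
    pd k (pd l f) u = pd l (pd k f) u := by
  have hd : DifferentiableAt ℝ (fderiv ℝ f) u :=
    ((hf.fderiv_of_isOpen hU (m := ∞) (by simp)).differentiableOn (by simp)).differentiableAt
      (hU.mem_nhds hu)
  have e : ∀ k l : Fin n, pd k (pd l f) u =
      fderiv ℝ (fderiv ℝ f) u (EuclideanSpace.single k 1) (EuclideanSpace.single l 1) := by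
    intro k l
    have := (hd.hasFDerivAt.clm_apply
      (hasFDerivAt_const (EuclideanSpace.single l (1 : ℝ)) u)).fderiv
    rw [pd]
    change fderiv ℝ (fun u => fderiv ℝ f u (EuclideanSpace.single l 1)) u _ = _
    rw [this]
    simp
  rw [e, e]
  exact (hf.contDiffAt (hU.mem_nhds hu)).isSymmSndFDerivAt
    (by
      rw [minSmoothness_of_isRCLikeNormedField]
      exact WithTop.coe_le_coe.2 (le_top : (2 : ℕ∞) ≤ ⊤)) _ _

end PartialDerivatives

/-! ### Derivative of the inverse matrix; ∇ with upper and lower indices -/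

namespace Coeffs

variable {P : Coeffs n} {U : Set (Coord n)} {u₀ : Coord n}

theorem IsAdmissible.contDiffOn_aLow (hP : P.IsAdmissible U) (i j : Fin n) :
    ContDiffOn ℝ ∞ (P.aLow i j) U :=
  contDiffOn_matrix_inv hP.smooth_a hP.nondegenerate i j

theorem IsAdmissible.differentiableAt_a (hP : P.IsAdmissible U) (hU : IsOpen U) (hu : u₀ ∈ U)
    (i j : Fin n) : DifferentiableAt ℝ (fun u => P.a u i j) u₀ :=
  ((hP.smooth_a i j).differentiableOn (by simp)).differentiableAt (hU.mem_nhds hu)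

theorem IsAdmissible.differentiableAt_aLow (hP : P.IsAdmissible U) (hU : IsOpen U) (hu : u₀ ∈ U)
    (i j : Fin n) : DifferentiableAt ℝ (P.aLow i j) u₀ :=
  ((hP.contDiffOn_aLow i j).differentiableOn (by simp)).differentiableAt (hU.mem_nhds hu)

/-- The matrix `∂ₖaⁱʲ`. -/
def pdA (P : Coeffs n) (k : Fin n) (u : Coord n) : Matrix (Fin n) (Fin n) ℝ :=
  Matrix.of fun i j => pd k (fun u => P.a u i j) u

/-- The matrix `∂ₖaᵢⱼ`. -/
def pdLow (P : Coeffs n) (k : Fin n) (u : Coord n) : Matrix (Fin n) (Fin n) ℝ :=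
  Matrix.of fun i j => pd k (P.aLow i j) u

theorem IsAdmissible.isUnit_det (hP : P.IsAdmissible U) (hu : u₀ ∈ U) : IsUnit (P.a u₀).det :=
  isUnit_iff_ne_zero.2 (hP.nondegenerate u₀ hu)

/-- The derivative of the inverse matrix. -/
theorem IsAdmissible.pdA_eq (hP : P.IsAdmissible U) (hU : IsOpen U) (hu : u₀ ∈ U) (k : Fin n) :
    P.pdA k u₀ = -(P.a u₀ * P.pdLow k u₀ * P.a u₀) := by
  have h : P.a u₀ * P.pdLow k u₀ + P.pdA k u₀ * (P.a u₀)⁻¹ = 0 := by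
    ext i j
    have e : (fun u => ∑ r, P.a u i r * P.aLow r j u) =ᶠ[𝓝 u₀] fun _ => if i = j then 1 else 0 := by
      filter_upwards [hU.mem_nhds hu] with u hu
      exact hP.sum_a_mul_aLow hu i j
    have e2 := pd_congr e k
    rw [pd_const, pd_sum (F := fun r u => P.a u i r * P.aLow r j u) fun r _ =>
      (hP.differentiableAt_a hU hu i r).mul (hP.differentiableAt_aLow hU hu r j)] at e2
    rw [Matrix.add_apply, Matrix.mul_apply, Matrix.mul_apply, ← Finset.sum_add_distrib,
      Matrix.zero_apply, ← e2]
    refine Finset.sum_congr rfl fun r _ => ?_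
    rw [pd_mul (hP.differentiableAt_a hU hu i r) (hP.differentiableAt_aLow hU hu r j)]
    simp only [pdA, pdLow, Matrix.of_apply, aLow]
    ring
  calc P.pdA k u₀ = P.pdA k u₀ * (P.a u₀)⁻¹ * P.a u₀ := by
        rw [Matrix.mul_assoc, Matrix.nonsing_inv_mul _ (hP.isUnit_det hu), Matrix.mul_one]
    _ = -(P.a u₀ * P.pdLow k u₀ * P.a u₀) := by
        rw [eq_neg_of_add_eq_zero_right h, Matrix.neg_mul]

/-- `∇ₖaⁱʲ = -aⁱʳ (∇ₖaᵣₛ) aˢʲ` in matrix form. -/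
theorem IsAdmissible.nablaUp_eq_neg (hP : P.IsAdmissible U) (hU : IsOpen U) (hu : u₀ ∈ U)
    (k : Fin n) :
    (Matrix.of fun i j => P.nablaUp k i j u₀) =
      -(P.a u₀ * (Matrix.of fun i j => P.nablaLow k i j u₀) * P.a u₀) := by
  let G : Matrix (Fin n) (Fin n) ℝ := Matrix.of fun i r => P.Gam i k r u₀
  have e1 : (Matrix.of fun i j => P.nablaUp k i j u₀) =
      P.pdA k u₀ + G * P.a u₀ + P.a u₀ * G.transpose := by
    ext i j
    simp [nablaUp, pdA, G, Matrix.mul_apply, mul_comm]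
  have e2 : (Matrix.of fun i j => P.nablaLow k i j u₀) =
      P.pdLow k u₀ - G.transpose * (P.a u₀)⁻¹ - (P.a u₀)⁻¹ * G := by
    ext i j
    simp [nablaLow, pdLow, G, Matrix.mul_apply, mul_comm, aLow]
  have i1 := Matrix.nonsing_inv_mul _ (hP.isUnit_det hu)
  have i2 := Matrix.mul_nonsing_inv _ (hP.isUnit_det hu)
  rw [e1, e2, hP.pdA_eq hU hu]
  simp only [Matrix.mul_sub, Matrix.sub_mul, Matrix.mul_assoc, i1, Matrix.mul_one]
  rw [← Matrix.mul_assoc (P.a u₀) (P.a u₀)⁻¹, i2, Matrix.one_mul]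
  abel

theorem IsAdmissible.nablaUp_eq_zero_iff (hP : P.IsAdmissible U) (hU : IsOpen U) (hu : u₀ ∈ U) :
    (∀ k i j, P.nablaUp k i j u₀ = 0) ↔ ∀ k i j, P.nablaLow k i j u₀ = 0 := by
  have i1 := Matrix.nonsing_inv_mul _ (hP.isUnit_det hu)
  have i2 := Matrix.mul_nonsing_inv _ (hP.isUnit_det hu)
  constructor
  · intro h k i j
    have e := hP.nablaUp_eq_neg hU hu k
    have hz : (Matrix.of fun i j => P.nablaUp k i j u₀) = 0 := by
      ext i j
      exact h k i j
    rw [hz, eq_comm, neg_eq_zero] at e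
    have e2 := congrArg (fun A => (P.a u₀)⁻¹ * A * (P.a u₀)⁻¹) e
    simp only [Matrix.mul_assoc, i2, Matrix.mul_one, Matrix.zero_mul, Matrix.mul_zero] at e2
    rw [← Matrix.mul_assoc, i1, Matrix.one_mul] at e2
    exact congrFun (congrFun e2 i) j
  · intro h k i j
    have e := hP.nablaUp_eq_neg hU hu k
    have hz : (Matrix.of fun i j => P.nablaLow k i j u₀) = 0 := by
      ext i j
      exact h k i j
    rw [hz, Matrix.mul_zero, Matrix.zero_mul, neg_zero] at e
    exact congrFun (congrFun e i) j

/-! ### The 2-form a, its exterior derivative, and the Jacobi equation -/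

theorem IsHamiltonianOn.aLow_antisymm (h : P.IsHamiltonianOn U) (hP : P.IsAdmissible U)
    (hu : u₀ ∈ U) (i j : Fin n) :
    P.aLow i j u₀ = -P.aLow j i u₀ := by
  have hdet := hP.isUnit_det hu
  have e : (P.a u₀).transpose = -P.a u₀ := by
    ext i j
    exact h.a_antisymm hu j i
  have e2 : ((P.a u₀)⁻¹).transpose = -(P.a u₀)⁻¹ := by
    rw [Matrix.transpose_nonsing_inv, e]
    refine Matrix.inv_eq_right_inv ?_
    rw [neg_mul_neg, Matrix.mul_nonsing_inv _ hdet]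
  have := congrFun (congrFun e2 j) i
  exact this

/-- The components of `da`. -/
def cyclicLow (P : Coeffs n) (i j k : Fin n) (u : Coord n) : ℝ :=
  pd i (P.aLow j k) u + pd j (P.aLow k i) u + pd k (P.aLow i j) u

theorem form_apply (u v w : Coord n) :
    P.form u ![v, w] = (1 / 2) * ∑ i, ∑ j, P.aLow i j u * (v i * w j - v j * w i) := by
  simp [form, dudu_apply, ContinuousAlternatingMap.sum_apply]

theorem IsHamiltonianOn.form_apply (h : P.IsHamiltonianOn U) (hP : P.IsAdmissible U)
    (hu : u₀ ∈ U) (v w : Coord n) :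
    P.form u₀ ![v, w] = ∑ i, ∑ j, P.aLow i j u₀ * v i * w j := by
  have e : ∑ i, ∑ j, P.aLow i j u₀ * (v j * w i) = -∑ i, ∑ j, P.aLow i j u₀ * (v i * w j) := by
    rw [Finset.sum_comm]
    simp only [← Finset.sum_neg_distrib]
    refine Finset.sum_congr rfl fun i _ => Finset.sum_congr rfl fun j _ => ?_
    rw [h.aLow_antisymm hP hu j i]
    ring
  rw [Coeffs.form_apply]
  simp only [mul_sub, Finset.sum_sub_distrib, e, mul_assoc]
  ring

theorem IsHamiltonianOn.form_single (h : P.IsHamiltonianOn U) (hP : P.IsAdmissible U)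
    (hu : u₀ ∈ U) (i j : Fin n) :
    P.form u₀ ![EuclideanSpace.single i 1, EuclideanSpace.single j 1] = P.aLow i j u₀ := by
  rw [h.form_apply hP hu]
  simp

theorem IsHamiltonianOn.isSymplecticOn_iff (h : P.IsHamiltonianOn U) (hP : P.IsAdmissible U) :
    P.IsSymplecticOn U ↔ P.IsClosedOn U := by
  refine ⟨fun hs => hs.1, fun hc => ⟨hc, fun u hu v hv => ?_⟩⟩
  have hdet : ((P.a u)⁻¹).det ≠ 0 := by
    rw [Matrix.det_nonsing_inv, Ring.inverse_eq_inv']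
    exact inv_ne_zero (hP.nondegenerate u hu)
  ext k
  refine eq_zero_of_sum_mul_eq_zero hdet (X := v) (fun j => ?_) k
  have := hv (EuclideanSpace.single j 1)
  rw [h.form_apply hP hu] at this
  simpa [Pi.single_apply, mul_comm, aLow] using this

theorem IsAdmissible.differentiableAt_form (hP : P.IsAdmissible U) (hU : IsOpen U)
    (hu : u₀ ∈ U) : DifferentiableAt ℝ P.form u₀ := by
  unfold form
  have h : DifferentiableAt ℝ (fun u => ∑ i, ∑ j, P.aLow i j u • dudu i j) u₀ :=
    DifferentiableAt.fun_sum fun i _ => DifferentiableAt.fun_sum fun j _ =>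
      (hP.differentiableAt_aLow hU hu i j).smul_const _
  exact h.const_smul (1 / 2 : ℝ)

/-- The exterior derivative is an alternating sum of directional derivatives; antisymmetry of aᵢⱼ
absorbs the sign of the middle term and makes the sum cyclic. -/
theorem IsHamiltonianOn.extDeriv_form_single (h : P.IsHamiltonianOn U) (hU : IsOpen U)
    (hP : P.IsAdmissible U) (hu : u₀ ∈ U) (s : Fin 3 → Fin n) :
    extDeriv P.form u₀ (fun m => EuclideanSpace.single (s m) 1) =
      P.cyclicLow (s 0) (s 1) (s 2) u₀ := by
  have e : ∀ i j k, fderiv ℝ (fun u => P.form u ![EuclideanSpace.single i 1,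
      EuclideanSpace.single j 1]) u₀ (EuclideanSpace.single k 1) = pd k (P.aLow i j) u₀ := by
    intro i j k
    refine pd_congr ?_ k
    filter_upwards [hU.mem_nhds hu] with u hu
    exact h.form_single hP hu i j
  have e' : pd (s 1) (P.aLow (s 2) (s 0)) u₀ = -pd (s 1) (P.aLow (s 0) (s 2)) u₀ := by
    have : P.aLow (s 2) (s 0) =ᶠ[𝓝 u₀] fun u => -P.aLow (s 0) (s 2) u := by
      filter_upwards [hU.mem_nhds hu] with u hu
      exact h.aLow_antisymm hP hu _ _
    rw [pd_congr this, pd, fderiv_fun_neg]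
    rfl
  have r : ∀ m : Fin 3, m.removeNth (fun m => (EuclideanSpace.single (s m) 1 : Coord n)) =
      ![EuclideanSpace.single (s (m.succAbove 0)) 1, EuclideanSpace.single (s (m.succAbove 1)) 1] := by
    intro m
    funext q
    fin_cases q <;> rfl
  rw [extDeriv_apply (hP.differentiableAt_form hU hu), Fin.sum_univ_three]
  simp only [r, e]
  rw [cyclicLow, e']
  simp [Fin.succAbove]

theorem IsHamiltonianOn.isClosedOn_iff_cyclicLow (h : P.IsHamiltonianOn U) (hU : IsOpen U)
    (hP : P.IsAdmissible U) :
    P.IsClosedOn U ↔ ∀ u ∈ U, ∀ i j k, P.cyclicLow i j k u = 0 := by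
  constructor
  · intro hc u hu i j k
    have := h.extDeriv_form_single hU hP hu ![i, j, k]
    rw [hc u hu] at this
    exact this.symm
  · intro hc u hu
    refine ContinuousAlternatingMap.toAlternatingMap_injective
      (Module.Basis.ext_alternating (EuclideanSpace.basisFun (Fin n) ℝ).toBasis fun s _ => ?_)
    have := h.extDeriv_form_single hU hP hu s
    rw [hc u hu] at this
    simpa using this

theorem sum_rotate (F : Fin n → Fin n → Fin n → ℝ) :
    ∑ r, ∑ s, ∑ t, F r s t = ∑ r, ∑ s, ∑ t, F s t r := by
  calc ∑ r, ∑ s, ∑ t, F r s t = ∑ r, ∑ t, ∑ s, F r s t :=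
        Finset.sum_congr rfl fun _ _ => Finset.sum_comm
    _ = ∑ t, ∑ r, ∑ s, F r s t := Finset.sum_comm

/-- Substituting ∂a = -a(∂a⁻¹)a puts three factors of a in every term, and relabelling collects them
around the components of da. The three transpositions of a in the target form produce the factor -1.
-/
theorem IsHamiltonianOn.jacobi_eq_cyclicLow (h : P.IsHamiltonianOn U) (hU : IsOpen U)
    (hP : P.IsAdmissible U) (hu : u₀ ∈ U) (i j k : Fin n) :
    ∑ r, (P.a u₀ i r * pd r (fun u => P.a u j k) u₀ + P.a u₀ j r * pd r (fun u => P.a u k i) u₀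
        + P.a u₀ k r * pd r (fun u => P.a u i j) u₀) =
      ∑ r, (∑ s, (∑ t, P.cyclicLow r s t u₀ * P.a u₀ t k) * P.a u₀ s j) * P.a u₀ r i * (-1) := by
  have hpd : ∀ r j k, pd r (fun u => P.a u j k) u₀ =
      ∑ s, ∑ t, P.a u₀ j s * P.a u₀ k t * pd r (P.aLow s t) u₀ := by
    intro r j k
    have := congrFun (congrFun (hP.pdA_eq hU hu r) j) k
    simp only [pdA, pdLow, Matrix.neg_apply, Matrix.mul_apply, Matrix.of_apply,
      Finset.sum_mul] at this
    rw [this, Finset.sum_comm, ← Finset.sum_neg_distrib]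
    refine Finset.sum_congr rfl fun s _ => ?_
    rw [← Finset.sum_neg_distrib]
    refine Finset.sum_congr rfl fun t _ => ?_
    rw [h.a_antisymm hu k t]
    ring
  have e : ∀ i j k, ∑ r, P.a u₀ i r * pd r (fun u => P.a u j k) u₀ =
      ∑ r, ∑ s, ∑ t, P.a u₀ i r * P.a u₀ j s * P.a u₀ k t * pd r (P.aLow s t) u₀ := by
    intro i j k
    simp only [hpd, Finset.mul_sum, mul_assoc]
  have e2 : ∑ r, P.a u₀ j r * pd r (fun u => P.a u k i) u₀ =
      ∑ r, ∑ s, ∑ t, P.a u₀ i r * P.a u₀ j s * P.a u₀ k t * pd s (P.aLow t r) u₀ := by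
    rw [e, sum_rotate]
    exact Finset.sum_congr rfl fun r _ => Finset.sum_congr rfl fun s _ =>
      Finset.sum_congr rfl fun t _ => by ring
  have e3 : ∑ r, P.a u₀ k r * pd r (fun u => P.a u i j) u₀ =
      ∑ r, ∑ s, ∑ t, P.a u₀ i r * P.a u₀ j s * P.a u₀ k t * pd t (P.aLow r s) u₀ := by
    rw [e, sum_rotate, sum_rotate]
    exact Finset.sum_congr rfl fun r _ => Finset.sum_congr rfl fun s _ =>
      Finset.sum_congr rfl fun t _ => by ring
  rw [Finset.sum_add_distrib, Finset.sum_add_distrib, e, e2, e3]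
  simp only [← Finset.sum_add_distrib, Finset.sum_mul]
  refine Finset.sum_congr rfl fun r _ => Finset.sum_congr rfl fun s _ =>
      Finset.sum_congr rfl fun t _ => ?_
  rw [cyclicLow, h.a_antisymm hu t k, h.a_antisymm hu s j, h.a_antisymm hu r i]
  ring

theorem IsHamiltonianOn.isClosedOn_iff_jacobiEqOn (h : P.IsHamiltonianOn U) (hU : IsOpen U)
    (hP : P.IsAdmissible U) : P.IsClosedOn U ↔ P.JacobiEqOn U := by
  rw [h.isClosedOn_iff_cyclicLow hU hP]
  constructor
  · intro hc u hu i j k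
    rw [h.jacobi_eq_cyclicLow hU hP hu]
    simp [hc u hu]
  · intro hJ u hu i j k
    have hd := hP.nondegenerate u hu
    -- The three contractions with the invertible matrix a are removed one at a time.
    have h1 : ∀ r j k, ∑ s, (∑ t, P.cyclicLow r s t u * P.a u t k) * P.a u s j = 0 := by
      intro r j k
      refine eq_zero_of_sum_mul_eq_zero hd (X := fun r =>
        ∑ s, (∑ t, P.cyclicLow r s t u * P.a u t k) * P.a u s j) (fun i => ?_) r
      have := hJ u hu i j k
      rw [h.jacobi_eq_cyclicLow hU hP hu, ← Finset.sum_mul] at this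
      linarith
    have h2 : ∀ r s k, ∑ t, P.cyclicLow r s t u * P.a u t k = 0 := fun r s k =>
      eq_zero_of_sum_mul_eq_zero hd (X := fun s => ∑ t, P.cyclicLow r s t u * P.a u t k)
        (fun j => h1 r j k) s
    exact eq_zero_of_sum_mul_eq_zero hd (X := fun k => P.cyclicLow i j k u) (fun l => h2 i j l) k

end Coeffs

/-! ### The Poisson bracket of functions -/

theorem pd_smul_add_smul {f g : Coord n → ℝ} {u : Coord n} (hf : DifferentiableAt ℝ f u)
    (hg : DifferentiableAt ℝ g u) (s t : ℝ) (k : Fin n) :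
    pd k (s • f + t • g) u = s * pd k f u + t * pd k g u := by
  rw [pd, fderiv_add (hf.const_smul s) (hg.const_smul t), fderiv_const_smul hf,
    fderiv_const_smul hg]
  rfl

namespace Coeffs

variable {P : Coeffs n} {U : Set (Coord n)} {u₀ : Coord n}

/-- The Hamiltonian vector field `aⁱʲ ∂ⱼf`. -/
def hamVec (P : Coeffs n) (f : Coord n → ℝ) (i : Fin n) (u : Coord n) : ℝ :=
  ∑ j, P.a u i j * pd j f u

theorem fnBracket_eq_sum_hamVec (f g : Coord n → ℝ) (u : Coord n) :
    P.fnBracket f g u = ∑ i, pd i f u * P.hamVec g i u := by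
  simp only [fnBracket, hamVec, Finset.mul_sum]
  exact Finset.sum_congr rfl fun i _ => Finset.sum_congr rfl fun j _ => by ring

theorem sum_a_mul_pd (h : P.IsHamiltonianOn U) (hu : u₀ ∈ U) (f : Coord n → ℝ) (j : Fin n) :
    ∑ i, P.a u₀ i j * pd i f u₀ = -P.hamVec f j u₀ := by
  rw [hamVec, ← Finset.sum_neg_distrib]
  refine Finset.sum_congr rfl fun i _ => ?_
  rw [h.a_antisymm hu i j]
  ring

/-- The derivative of `{f, g}`. -/
theorem IsHamiltonianOn.pd_fnBracket (h : P.IsHamiltonianOn U) (hU : IsOpen U)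
    (hP : P.IsAdmissible U) (hu : u₀ ∈ U) {f g : Coord n → ℝ} (hf : ContDiffOn ℝ ∞ f U)
    (hg : ContDiffOn ℝ ∞ g U) (k : Fin n) :
    pd k (P.fnBracket f g) u₀ =
      ∑ i, ∑ j, pd k (fun u => P.a u i j) u₀ * pd i f u₀ * pd j g u₀
        + ∑ i, pd k (pd i f) u₀ * P.hamVec g i u₀ - ∑ j, pd k (pd j g) u₀ * P.hamVec f j u₀ := by
  have da := hP.differentiableAt_a hU hu
  have df : ∀ i, DifferentiableAt ℝ (pd i f) u₀ := fun i =>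
    ((contDiffOn_pd hU hf i).differentiableOn (by simp)).differentiableAt (hU.mem_nhds hu)
  have dg : ∀ i, DifferentiableAt ℝ (pd i g) u₀ := fun i =>
    ((contDiffOn_pd hU hg i).differentiableOn (by simp)).differentiableAt (hU.mem_nhds hu)
  have e : pd k (P.fnBracket f g) u₀ = ∑ i, ∑ j,
      (pd k (fun u => P.a u i j) u₀ * pd i f u₀ * pd j g u₀
        + pd k (pd i f) u₀ * (P.a u₀ i j * pd j g u₀)
        + pd k (pd j g) u₀ * (P.a u₀ i j * pd i f u₀)) := by
    change pd k (fun u => ∑ i, ∑ j, P.a u i j * pd i f u * pd j g u) u₀ = _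
    rw [pd_sum (F := fun i u => ∑ j, P.a u i j * pd i f u * pd j g u) fun i _ =>
      DifferentiableAt.fun_sum fun j _ => ((da i j).fun_mul (df i)).fun_mul (dg j)]
    refine Finset.sum_congr rfl fun i _ => ?_
    rw [pd_sum (F := fun j u => P.a u i j * pd i f u * pd j g u) fun j _ =>
      ((da i j).fun_mul (df i)).fun_mul (dg j)]
    refine Finset.sum_congr rfl fun j _ => ?_
    rw [pd_mul ((da i j).fun_mul (df i)) (dg j), pd_mul (da i j) (df i)]
    ring
  rw [e]
  simp only [Finset.sum_add_distrib]
  rw [sub_eq_add_neg]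
  congr 1
  · simp only [hamVec, Finset.mul_sum]
  · rw [Finset.sum_comm, ← Finset.sum_neg_distrib]
    refine Finset.sum_congr rfl fun j _ => ?_
    rw [← Finset.mul_sum, sum_a_mul_pd h hu, mul_neg]

theorem sum_pd_pd_comm (hU : IsOpen U) (hu : u₀ ∈ U) {f : Coord n → ℝ}
    (hf : ContDiffOn ℝ ∞ f U) (X Y : Fin n → ℝ) :
    ∑ k, (∑ i, pd k (pd i f) u₀ * X i) * Y k = ∑ k, (∑ i, pd k (pd i f) u₀ * Y i) * X k := by
  simp only [Finset.sum_mul]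
  rw [Finset.sum_comm]
  refine Finset.sum_congr rfl fun i _ => Finset.sum_congr rfl fun k _ => ?_
  rw [pd_comm hU hf hu k i]
  ring

/-- The first-order part of `{{f, g}, h}`. -/
theorem sum_pd_a_mul_hamVec (f g h : Coord n → ℝ) (u : Coord n) :
    ∑ k, (∑ i, ∑ j, pd k (fun u => P.a u i j) u * pd i f u * pd j g u) * P.hamVec h k u =
      ∑ i, ∑ j, ∑ l, (∑ k, P.a u k l * pd k (fun u => P.a u i j) u) *
        (pd i f u * pd j g u * pd l h u) := by
  simp only [hamVec, Finset.sum_mul]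
  simp only [Finset.mul_sum]
  rw [Finset.sum_comm]
  refine Finset.sum_congr rfl fun i _ => ?_
  rw [Finset.sum_comm]
  refine Finset.sum_congr rfl fun j _ => ?_
  rw [Finset.sum_comm]
  exact Finset.sum_congr rfl fun l _ => Finset.sum_congr rfl fun k _ => by ring

/-- Writing X for the Hamiltonian vector field, the double bracket is a term in a∂a plus Hess f(X_g,
X_e) - Hess g(X_f, X_e). This isolates the second derivatives that must cancel cyclically. -/
theorem IsHamiltonianOn.fnBracket_fnBracket (h : P.IsHamiltonianOn U) (hU : IsOpen U)
    (hP : P.IsAdmissible U) (hu : u₀ ∈ U) {f g : Coord n → ℝ} (hf : ContDiffOn ℝ ∞ f U)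
    (hg : ContDiffOn ℝ ∞ g U) (e : Coord n → ℝ) :
    P.fnBracket (P.fnBracket f g) e u₀ =
      ∑ i, ∑ j, ∑ l, (∑ k, P.a u₀ k l * pd k (fun u => P.a u i j) u₀) *
        (pd i f u₀ * pd j g u₀ * pd l e u₀)
      + ∑ k, (∑ i, pd k (pd i f) u₀ * P.hamVec g i u₀) * P.hamVec e k u₀
      - ∑ k, (∑ i, pd k (pd i g) u₀ * P.hamVec f i u₀) * P.hamVec e k u₀ := by
  rw [← sum_pd_a_mul_hamVec, fnBracket_eq_sum_hamVec]
  simp only [h.pd_fnBracket hU hP hu hf hg, sub_mul, add_mul, Finset.sum_add_distrib,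
    Finset.sum_sub_distrib]

theorem IsHamiltonianOn.isPoissonOn_iff_jacobiEqOn (h : P.IsHamiltonianOn U) (hU : IsOpen U)
    (hP : P.IsAdmissible U) : P.IsPoissonOn U ↔ P.JacobiEqOn U := by
  have hd : ∀ {f : Coord n → ℝ}, ContDiffOn ℝ ∞ f U → ∀ {u}, u ∈ U → DifferentiableAt ℝ f u :=
    fun hf _ hu => (hf.differentiableOn (by simp)).differentiableAt (hU.mem_nhds hu)
  constructor
  · intro hp u hu i j k
    have sm : ∀ i : Fin n, ContDiffOn ℝ ∞ (fun u : Coord n => u i) U := fun i =>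
      (EuclideanSpace.proj (𝕜 := ℝ) i).contDiff.contDiffOn
    -- The Jacobi identity on the coordinate functions is the Jacobi equation up to sign.
    have e1 : ∀ i j : Fin n, P.fnBracket (fun u => u i) (fun u => u j) = fun u => P.a u i j := by
      intro i j
      funext u
      simp [fnBracket, pd_coord]
    have e2 : ∀ (f : Coord n → ℝ) (l : Fin n), P.fnBracket f (fun u => u l) u =
        -∑ r, P.a u l r * pd r f u := by
      intro f l
      rw [← Finset.sum_neg_distrib]
      refine Finset.sum_congr rfl fun r _ => ?_
      simp only [pd_coord, mul_ite, mul_one, mul_zero, Finset.sum_ite_eq', Finset.mem_univ, if_true]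
      rw [h.a_antisymm hu r l]
      ring
    have := hp.jacobi _ _ _ (sm i) (sm j) (sm k) u hu
    simp only [e1, e2] at this
    rw [Finset.sum_add_distrib, Finset.sum_add_distrib]
    linarith
  · intro hJ
    refine ⟨fun f g hf hg => ?_, fun f g _ _ u hu => ?_, fun f g e hf hg _ s t u hu => ?_,
      fun f g e hf hg _ u hu => ?_, fun f g e hf hg he u hu => ?_⟩
    · exact ContDiffOn.sum fun i _ => ContDiffOn.sum fun j _ =>
        ((hP.smooth_a i j).mul (contDiffOn_pd hU hf i)).mul (contDiffOn_pd hU hg j)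
    · simp only [fnBracket]
      rw [Finset.sum_comm]
      simp only [← Finset.sum_neg_distrib]
      refine Finset.sum_congr rfl fun i _ => Finset.sum_congr rfl fun j _ => ?_
      rw [h.a_antisymm hu j i]
      ring
    · simp only [fnBracket_eq_sum_hamVec, Finset.mul_sum, ← Finset.sum_add_distrib]
      refine Finset.sum_congr rfl fun i _ => ?_
      rw [pd_smul_add_smul (hd hf hu) (hd hg hu)]
      ring
    · simp only [fnBracket_eq_sum_hamVec, Finset.mul_sum, ← Finset.sum_add_distrib]
      refine Finset.sum_congr rfl fun i _ => ?_
      have := pd_mul (hd hf hu) (hd hg hu) i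
      change pd i (fun u => f u * g u) u * _ = _
      rw [this]
      ring
    -- Each of the three Hessians occurs twice with opposite signs and its arguments swapped;
    -- symmetry of second derivatives cancels them.
    · rw [h.fnBracket_fnBracket hU hP hu hf hg, h.fnBracket_fnBracket hU hP hu hg he,
        h.fnBracket_fnBracket hU hP hu he hf, sum_pd_pd_comm hU hu hf (P.hamVec e · u),
        sum_pd_pd_comm hU hu hg (P.hamVec f · u), sum_pd_pd_comm hU hu he (P.hamVec g · u)]
      have z : ∑ i, ∑ j, ∑ l, (∑ k, P.a u k l * pd k (fun u => P.a u i j) u) *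
            (pd i f u * pd j g u * pd l e u)
          + ∑ i, ∑ j, ∑ l, (∑ k, P.a u k l * pd k (fun u => P.a u i j) u) *
            (pd i g u * pd j e u * pd l f u)
          + ∑ i, ∑ j, ∑ l, (∑ k, P.a u k l * pd k (fun u => P.a u i j) u) *
            (pd i e u * pd j f u * pd l g u) = 0 := by
        -- The second sum is rotated once and the third twice, so that all three carry the monomial
        -- ∂ᵢf ∂ⱼg ∂ₗe.
        rw [sum_rotate fun i j l => (∑ k, P.a u k l * pd k (fun u => P.a u i j) u) *
            (pd i g u * pd j e u * pd l f u),
          sum_rotate fun i j l => (∑ k, P.a u k l * pd k (fun u => P.a u i j) u) *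
            (pd i e u * pd j f u * pd l g u),
          sum_rotate fun i j l => (∑ k, P.a u k i * pd k (fun u => P.a u j l) u) *
            (pd j e u * pd l f u * pd i g u)]
        simp only [← Finset.sum_add_distrib]
        refine Finset.sum_eq_zero fun i _ => Finset.sum_eq_zero fun j _ =>
          Finset.sum_eq_zero fun l _ => ?_
        have hJ' := hJ u hu i j l
        simp only [Finset.sum_add_distrib] at hJ'
        have flip : ∀ i j l, ∑ k, P.a u k l * pd k (fun u => P.a u i j) u =
            -∑ k, P.a u l k * pd k (fun u => P.a u i j) u := by
          intro i j l
          rw [← Finset.sum_neg_distrib]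
          refine Finset.sum_congr rfl fun k _ => ?_
          rw [h.a_antisymm hu k l]
          ring
        simp only [flip]
        linear_combination (-(pd i f u * pd j g u * pd l e u)) * hJ'
      linarith

end Coeffs
end LoopPoisson

end

/-- Each equivalence holds chart by chart. The hubs are the Jacobi equation and b = 2c, joined by
`jacobiEqOn_iff`. -/
theorem mainTheorem10 {n : ℕ} {M : Type*} [TopologicalSpace M]
    [ChartedSpace (LoopPoisson.Coord n) M] [IsManifold (𝓡 n) ∞ M]
    (P : LoopPoisson.DegreeTwoOperator n M) (hP : P.IsHamiltonian) :
    List.TFAE [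
      -- the 2-form is closed
      ∀ e, (P.coeffs e).IsClosedOn e.1.target,
      -- the 2-form is symplectic
      ∀ e, (P.coeffs e).IsSymplecticOn e.1.target,
      -- the Jacobi equation for the bivector
      ∀ e, (P.coeffs e).JacobiEqOn e.1.target,
      -- the bivector defines a Poisson bracket of functions
      ∀ e, (P.coeffs e).IsPoissonOn e.1.target,
      -- the connection preserves the bivector
      ∀ e, ∀ u ∈ e.1.target, ∀ k i j, (P.coeffs e).nablaUp k i j u = 0,
      -- the connection preserves the 2-form
      ∀ e, ∀ u ∈ e.1.target, ∀ k i j, (P.coeffs e).nablaLow k i j u = 0,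
      -- b = 2c
      ∀ e, ∀ u ∈ e.1.target, ∀ i j k, (P.coeffs e).b i j k u = 2 * (P.coeffs e).c i j k u,
      -- the two connections coincide
      ∀ e, ∀ u ∈ e.1.target, ∀ k i j,
        (P.coeffs e).Gam k i j u = (P.coeffs e).GamBar k i j u] := by
  have hU : ∀ e : atlas (LoopPoisson.Coord n) M, IsOpen e.1.target := fun e => e.1.open_target
  have hA := P.admissible
  tfae_have 2 ↔ 1 := forall_congr' fun e => (hP e).isSymplecticOn_iff (hA e)
  tfae_have 1 ↔ 3 := forall_congr' fun e => (hP e).isClosedOn_iff_jacobiEqOn (hU e) (hA e)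
  tfae_have 4 ↔ 3 := forall_congr' fun e => (hP e).isPoissonOn_iff_jacobiEqOn (hU e) (hA e)
  tfae_have 3 ↔ 7 := forall_congr' fun e => (hP e).jacobiEqOn_iff (hU e) (hA e)
  tfae_have 5 ↔ 6 := forall_congr' fun e => forall₂_congr fun u hu =>
    (hA e).nablaUp_eq_zero_iff (hU e) hu
  tfae_have 7 ↔ 8 := forall_congr' fun e => forall₂_congr fun u hu => (hA e).b_eq_iff hu
  tfae_have 5 ↔ 7 := forall_congr' fun e => forall₂_congr fun u hu => by
    simp only [(hP e).nablaUp_eq (hU e) (hA e) hu, sub_eq_zero]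
    exact ⟨fun h i j k => h k i j, fun h k i j => h i j k⟩
  tfae_finish
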